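/- **Notation.** Let $n$ be a natural number, let $(\cdot,\cdot)$ and $\|\cdot\|$ be the standard inner product and norm on $\mathbb R^n$, and extend the inner product bilinearly to $\mathbb C^n$. A *weight* on $\mathbb R^n$ is an arbitrary bounded function $w:\mathbb R^n\to[0,\infty)$. Put $$\mathcal C_w=\{f\in C^\infty(\mathbb R^n,\mathbb C)\mid \lim_{\|x\|\to\infty}\partial^\alpha f(x)\,w(x)=0\ \text{ for all multi-indices }\alpha\},$$ with the locally convex (not necessarily Hausdorff) topology defined by the seminorms $p_\alpha(f)=\sup_x|\partial^\alpha f(x)\,w(x)|$. Write $e_{i\lambda}(x)=e^{i(\lambda,x)}$ for $\lambda\in\mathbb C^n$, $x\in\mathbb R^n$; let $\mathcal P$ be the space of complex polynomials on $\mathbb R^n$ and $\mathcal S$ the Schwartz space on $\mathbb R^n$ with its usual topology. All spans are complex. **Classes of weights.** * $\mathcal W_0$ is the set of weights $w$ with $\lim_{\|x\|\to\infty}w(x)=0$. * $\mathcal W_{\rm qa}$ (*quasi-analytic weights*) is the set of weights $w$ for which there is a basis $v_1,\dots,v_n$ of $\mathbb R^n$ such that $\sum_{m=1}^\infty\big(\sup_{x}|(v_j,x)|^m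 w(x)\big)^{-1/m}=\infty$ for $j=1,\dots,n$ (with $0^{-1/m}=\infty$ and $\infty^{-1/m}=0$). * $\mathcal W_{\rm hol}$ (*holomorphic weights*) is the set of weights $w$ for which there are $C\ge 0$ and $\epsilon>0$ with $w(x)\le Ce^{-\epsilon\|x\|}$ for all $x$. For such $w$, $\tau_w\in(0,\infty]$ is the supremum of all $\epsilon>0$ for which such a $C$ exists, and $\mathbb C_w=\{\lambda\in\mathbb C^n\mid\|\operatorname{Im}\lambda\|<\tau_w\}$. These classes satisfy $\mathcal W_{\rm hol}\subset\mathcal W_{\rm qa}\subset\mathcal W_0$. **Admissible spaces.** An *admissible space* for a weight $w$ is any of the following subspaces of $C^\infty(\mathbb R^n)$: 1. if $w\notin\mathcal W_0$: a dense subspace of $\mathcal S$; 2. if $w\in\mathcal W_0\setminus\mathcal W_{\rm qa}$: a dense subspace of $\mathcal S$; or $\operatorname{span}\{e_{i\lambda}\mid\lambda\in E\}$ with $E\subset\mathbb R^n$ dense; 3. if $w\in\mathcal W_{\rm qa}\setminus\mathcal W_{\rm hol}$: a dense subspace of $\mathcal S$; or $\operatorname{span}\{e_{i\lambda}\mid\lambda\in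 E\}$ with $E\subset\mathbb R^n$ such that $\overline E$ has nonempty interior; or $\mathcal P$; 4. if $w\in\mathcal W_{\rm hol}$: a dense subspace of $\mathcal S$; or $\operatorname{span}\{e_{i\lambda}\mid\lambda\in E\}$ with $E\subset\mathbb C_w$ such that every holomorphic function on $\mathbb C_w$ vanishing on $E$ is identically zero on $\mathbb C_w$; or $\mathcal P$. **Theorem.** Let $w$ be a weight on $\mathbb R^n$. Then all admissible spaces for $w$ are subspaces of $\mathcal C_w$ and they all have the same closure in $\mathcal C_w$. In fact, they are all dense in $\mathcal C_w$. -/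

import Mathlib

open scoped ContDiff SchwartzMap Topology

noncomputable section

namespace QAWeight

/-- `ℝⁿ` with its Euclidean inner product and norm. -/
abbrev Rn (n : ℕ) : Type := EuclideanSpace ℝ (Fin n)

/-- `ℂⁿ`. -/
abbrev Cn (n : ℕ) : Type := EuclideanSpace ℂ (Fin n)

/-! ### Smooth functions and their partial derivatives -/

/-- `C^∞(ℝⁿ)`: the complex vector space of smooth complex-valued functions on `ℝⁿ`. -/
def smooth (n : ℕ) : Submodule ℂ (Rn n → ℂ) where
  carrier := {f | ContDiff ℝ ∞ f}
  add_mem' {f g} hf hg := by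
    rw [Set.mem_ofPred_eq] at *
    exact hf.add hg
  zero_mem' := by
    rw [Set.mem_ofPred_eq]
    exact contDiff_const
  smul_mem' c f hf := by
    rw [Set.mem_ofPred_eq] at *
    exact contDiff_const.smul hf

theorem smooth.contDiff {n : ℕ} (f : smooth n) : ContDiff ℝ ∞ f.1 := f.2

theorem smooth.differentiableAt {n : ℕ} (f : smooth n) (x : Rn n) : DifferentiableAt ℝ f.1 x :=
  (smooth.contDiff f).differentiable (by simp) x

/-- The partial derivative `∂_j`, as a linear operator on `C^∞(ℝⁿ)`. -/
def partialD {n : ℕ} (j : Fin n) : smooth n →ₗ[ℂ] smooth n where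
  toFun f := ⟨fun x => fderiv ℝ f.1 x (EuclideanSpace.single j 1),
    ((smooth.contDiff f).fderiv_right (m := ∞) (by simp)).clm_apply contDiff_const⟩
  map_add' f g := by
    ext x
    change fderiv ℝ (f.1 + g.1) x _ = fderiv ℝ f.1 x _ + fderiv ℝ g.1 x _
    rw [fderiv_add (smooth.differentiableAt f x) (smooth.differentiableAt g x)]
    rfl
  map_smul' c f := by
    ext x
    change fderiv ℝ (c • f.1) x _ = c • fderiv ℝ f.1 x _
    rw [fderiv_const_smul (smooth.differentiableAt f x)]
    rfl

/-- For a multi-index `α`, the operator `∂^α = ∂₁^{α₁} ⋯ ∂ₙ^{αₙ}` on `C^∞(ℝⁿ)`. -/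
def multiD {n : ℕ} (α : Fin n → ℕ) : smooth n →ₗ[ℂ] smooth n :=
  (List.ofFn fun j => (partialD j : Module.End ℂ (smooth n)) ^ α j).prod

/-! ### Weights and classes of weights -/

/-- A weight on `ℝⁿ`: an arbitrary bounded function `ℝⁿ → [0, ∞)`. -/
structure Weight (n : ℕ) where
  toFun : Rn n → ℝ
  nonneg' : ∀ x, 0 ≤ toFun x
  bounded' : ∃ C : ℝ, ∀ x, toFun x ≤ C

instance (n : ℕ) : CoeFun (Weight n) (fun _ => Rn n → ℝ) := ⟨Weight.toFun⟩

namespace Weight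

variable {n : ℕ}

/-- The class `𝒲₀`: weights tending to zero at infinity. -/
def VanishesAtInfinity (w : Weight n) : Prop :=
  Filter.Tendsto (fun x => w x) (Filter.cocompact (Rn n)) (𝓝 0)

/-- `M_w(v, m) = sup_x |(v, x)|^m w(x) ∈ [0, ∞]`. -/
def M (w : Weight n) (v : Rn n) (m : ℕ) : ENNReal :=
  ⨆ x : Rn n, ENNReal.ofReal (|inner ℝ v x| ^ m * w x)

/-- `w` is quasi-analytic with respect to the basis `v`:
`∑_{m ≥ 1} M_w(v_j, m)^{-1/m} = ∞` for every `j`, with `0^{-1/m} = ∞` and `∞^{-1/m} = 0`. -/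
def IsQuasiAnalyticWrt (w : Weight n) (v : Module.Basis (Fin n) ℝ (Rn n)) : Prop :=
  ∀ j, ∑' m : ℕ, w.M (v j) (m + 1) ^ (-(1 / ((m : ℝ) + 1))) = ⊤

/-- `w` is quasi-analytic with respect to some basis of `ℝⁿ`. -/
def IsQuasiAnalytic (w : Weight n) : Prop :=
  ∃ v : Module.Basis (Fin n) ℝ (Rn n), w.IsQuasiAnalyticWrt v

/-- `w(x) ≤ C exp(-ε‖x‖)` on `ℝⁿ` for some constant `C ≥ 0`. -/
def HasExpDecay (w : Weight n) (ε : ℝ) : Prop :=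
  ∃ C : ℝ, 0 ≤ C ∧ ∀ x, w x ≤ C * Real.exp (-ε * ‖x‖)

/-- `w` is a holomorphic weight: it decays exponentially at some rate `ε > 0`. -/
def IsHolomorphic (w : Weight n) : Prop := ∃ ε : ℝ, 0 < ε ∧ w.HasExpDecay ε

/-- `τ_w ∈ [0, ∞]`: the supremum of all `ε > 0` such that `w` decays exponentially at rate `ε`. -/
def tau (w : Weight n) : ENNReal :=
  ⨆ (ε : ℝ) (_ : 0 < ε ∧ w.HasExpDecay ε), ENNReal.ofReal ε

/-- The tube domain `{λ ∈ ℂⁿ | ‖Im λ‖ < τ_w}` of a holomorphic weight. -/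
def tube (w : Weight n) : Set (Cn n) :=
  {z | ENNReal.ofReal ‖(WithLp.toLp 2 (fun j => (z j).im) : Rn n)‖ < w.tau}

end Weight

/-! ### The locally convex space `C_w` -/

variable {n : ℕ}

/-- The functions `f ∈ C^∞(ℝⁿ)` such that `∂^α f(x) w(x) → 0` as `‖x‖ → ∞`, for every `α`,
as a subspace of `C^∞(ℝⁿ)`. -/
def cwSub (w : Weight n) : Submodule ℂ (smooth n) where
  carrier := {f | ∀ α : Fin n → ℕ,
    Filter.Tendsto (fun x => (multiD α f).1 x * (w x : ℂ)) (Filter.cocompact (Rn n)) (𝓝 0)}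
  add_mem' hf hg α := by simpa [add_mul] using (hf α).add (hg α)
  zero_mem' α := by simpa using tendsto_const_nhds
  smul_mem' c f hf α := by simpa [mul_assoc] using (hf α).const_mul c

/-- The vector space `C_w`. It is a type of its own, so that it carries only the topology
defined by the seminorms `p_α` below (and not that of pointwise convergence). -/
def Cw (w : Weight n) : Type := cwSub w

instance (w : Weight n) : AddCommGroup (Cw w) := inferInstanceAs (AddCommGroup (cwSub w))
instance (w : Weight n) : Module ℂ (Cw w) := inferInstanceAs (Module ℂ (cwSub w))

/-- The inclusion `C_w ⊆ C^∞(ℝⁿ)`. -/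
def Cw.incl (w : Weight n) : Cw w →ₗ[ℂ] smooth n := (cwSub w).subtype

theorem Cw.bddAbove (w : Weight n) (α : Fin n → ℕ) (f : Cw w) :
    BddAbove (Set.range fun x => ‖(multiD α (Cw.incl w f)).1 x * (w x : ℂ)‖) := by
  have h0 : Filter.Tendsto (fun x => (multiD α (Cw.incl w f)).1 x * (w x : ℂ))
      (Filter.cocompact (Rn n)) (𝓝 0) := f.2 α
  replace h0 := h0.norm
  rw [norm_zero] at h0
  have h1 := h0.eventually (gt_mem_nhds (zero_lt_one' ℝ))
  rw [Filter.Eventually, Filter.mem_cocompact] at h1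
  obtain ⟨K, hK, hKs⟩ := h1
  have hc : Continuous (multiD α (Cw.incl w f)).1 :=
    (smooth.contDiff (multiD α (Cw.incl w f))).continuous
  obtain ⟨A, hA⟩ := hK.exists_bound_of_continuousOn hc.continuousOn
  obtain ⟨B, hB⟩ := w.bounded'
  refine ⟨max (A * B) 1, ?_⟩
  rintro _ ⟨x, rfl⟩
  by_cases hx : x ∈ K
  · refine le_max_of_le_left ?_
    have hw : ‖(w x : ℂ)‖ ≤ B := by
      rw [Complex.norm_real, Real.norm_of_nonneg (w.nonneg' x)]
      exact hB x
    have hA' := hA x hx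
    change ‖(multiD α (Cw.incl w f)).1 x * (w x : ℂ)‖ ≤ _
    rw [norm_mul]
    exact mul_le_mul hA' hw (norm_nonneg _) ((norm_nonneg _).trans hA')
  · exact le_max_of_le_right (le_of_lt (hKs hx))

/-- The seminorm `p_α(f) = sup_x |∂^α f(x) w(x)|` on `C_w`. -/
def Cw.p (w : Weight n) (α : Fin n → ℕ) : Seminorm ℂ (Cw w) :=
  Seminorm.of (fun f => ⨆ x, ‖(multiD α (Cw.incl w f)).1 x * (w x : ℂ)‖)
    (fun f g => by
      refine ciSup_le fun x => ?_
      refine le_trans ?_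
        (add_le_add (le_ciSup (Cw.bddAbove w α f) x) (le_ciSup (Cw.bddAbove w α g) x))
      refine le_trans (le_of_eq ?_) (norm_add_le _ _)
      simp [add_mul])
    (fun c f => by
      rw [Real.mul_iSup_of_nonneg (norm_nonneg c)]
      congr 1
      ext x
      simp [mul_assoc])

/-- The topology of `C_w`: the locally convex topology defined by the seminorms `p_α`. -/
instance (w : Weight n) : TopologicalSpace (Cw w) :=
  SeminormFamily.moduleFilterBasis (Cw.p w) |>.topology

theorem Cw.withSeminorms (w : Weight n) : WithSeminorms (Cw.p w) :=
  ⟨rfl⟩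

/-! ### Exponentials, polynomials and Schwartz functions in `C^∞(ℝⁿ)` -/

/-- The exponential `e_{iλ} : x ↦ exp(i (λ, x))` for `λ ∈ ℂⁿ`, where `(λ, x) = ∑_j λ_j x_j`. -/
def expFun (l : Cn n) : smooth n :=
  ⟨fun x => Complex.exp (Complex.I * ∑ j, l j * (x j : ℂ)), by
    change ContDiff ℝ ∞ _
    refine ContDiff.cexp (contDiff_const.mul (ContDiff.sum fun j _ => contDiff_const.mul ?_))
    exact Complex.ofRealCLM.contDiff.comp (EuclideanSpace.proj (𝕜 := ℝ) j).contDiff⟩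

/-- The inclusion `ℝⁿ ⊆ ℂⁿ`. -/
def ofRn (x : Rn n) : Cn n := WithLp.toLp 2 (fun j => (x j : ℂ))

/-- The complex span of the exponentials `e_{iλ}`, `λ ∈ E ⊆ ℂⁿ`. -/
def expSpan (E : Set (Cn n)) : Submodule ℂ (smooth n) := Submodule.span ℂ (expFun '' E)

/-- A complex polynomial in `n` variables as a function on `ℝⁿ`. -/
def polyMap (n : ℕ) : MvPolynomial (Fin n) ℂ →ₗ[ℂ] smooth n where
  toFun P := ⟨fun x => MvPolynomial.eval (fun j => (x j : ℂ)) P, by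
    change ContDiff ℝ ∞ _
    induction P using MvPolynomial.induction_on with
    | C a => simpa using contDiff_const
    | add p q hp hq => simpa using hp.add hq
    | mul_X p j hp =>
      simp only [map_mul, MvPolynomial.eval_X]
      exact hp.mul
        (Complex.ofRealCLM.contDiff.comp (EuclideanSpace.proj (𝕜 := ℝ) j).contDiff)⟩
  map_add' P Q := by ext x; simp
  map_smul' c P := by ext x; simp

/-- The space of complex-valued polynomials on `ℝⁿ`. -/
def polySub (n : ℕ) : Submodule ℂ (smooth n) := LinearMap.range (polyMap n)

/-- The inclusion of the Schwartz space in `C^∞(ℝⁿ)`. -/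
def schwartzIncl (n : ℕ) : 𝓢(Rn n, ℂ) →ₗ[ℂ] smooth n where
  toFun f := ⟨f, f.smooth ⊤⟩
  map_add' _ _ := rfl
  map_smul' _ _ := rfl

/-! ### Admissible spaces -/

/-- `L` is a dense subspace of the Schwartz space (with its usual topology). -/
def IsDenseInSchwartz (L : Submodule ℂ (smooth n)) : Prop :=
  ∃ S : Submodule ℂ 𝓢(Rn n, ℂ), Dense (S : Set 𝓢(Rn n, ℂ)) ∧ L = S.map (schwartzIncl n)

/-- `E ⊆ Ω` is a uniqueness set for `Ω`: every holomorphic function on `Ω` that vanishes on `E`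
vanishes on `Ω`. -/
def IsUniquenessSet (E Ω : Set (Cn n)) : Prop :=
  E ⊆ Ω ∧ ∀ f : Cn n → ℂ, DifferentiableOn ℂ f Ω → (∀ z ∈ E, f z = 0) → ∀ z ∈ Ω, f z = 0

/-- The subspace `L` of `C^∞(ℝⁿ)` is an admissible space for the weight `w`. -/
def IsAdmissible (w : Weight n) (L : Submodule ℂ (smooth n)) : Prop :=
  (¬ w.VanishesAtInfinity ∧ IsDenseInSchwartz L) ∨
  (w.VanishesAtInfinity ∧ ¬ w.IsQuasiAnalytic ∧
    (IsDenseInSchwartz L ∨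
      ∃ E : Set (Rn n), Dense E ∧ L = expSpan (ofRn '' E))) ∨
  (w.IsQuasiAnalytic ∧ ¬ w.IsHolomorphic ∧
    (IsDenseInSchwartz L ∨
      (∃ E : Set (Rn n), (interior (closure E)).Nonempty ∧ L = expSpan (ofRn '' E)) ∨
      L = polySub n)) ∨
  (w.IsHolomorphic ∧
    (IsDenseInSchwartz L ∨
      (∃ E : Set (Cn n), IsUniquenessSet E w.tube ∧ L = expSpan E) ∨
      L = polySub n))

/-- For a subspace `L` of `C^∞(ℝⁿ)`, the subspace `L ∩ C_w` of `C_w`. -/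
def Cw.restrict (w : Weight n) (L : Submodule ℂ (smooth n)) : Submodule ℂ (Cw w) :=
  L.comap (Cw.incl w)

end QAWeight

end

noncomputable section

namespace QAWeight


/-! ### Quasi-analyticity on the line -/

/-! Two facts settle dense subspaces of $\mathcal S$: the inclusion $\mathcal S\to\mathcal C_w$ is
continuous, and its range is dense for every weight, by dilated cutoffs
(`Cw.denseRange_ofSchwartz`).

For the other spaces density becomes a duality statement. The tuple of the functions
$\partial^\alpha f\cdot w$, for finitely many $\alpha$, lives in a finite product of Banach spaces
of bounded functions; no regularity is asked of these functions because $w$ need not even be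
measurable. By Hahn–Banach (`dense_of_functional`) it suffices that every continuous functional $T$
on this product which kills the space also kills $\mathcal S$. If $w\to0$, then $\lambda\mapsto
e_{i\lambda}$ is norm continuous on $\mathbb R^n$, and Fourier inversion writes a Schwartz function
as a Bochner integral of exponentials (`functional_schwartz_eq_zero`). So everything reduces to
showing $F(\lambda)=T(e_{i\lambda})=0$ for real $\lambda$.

For dense $E$ this is continuity. For a holomorphic weight, $F$ is holomorphic on the tube, and the
uniqueness property of $E$ applies. For a quasi-analytic weight, the derivatives of $F$ along $v$
are $T((i(v,x))^m e_{i\lambda})$; they are controlled by the moments of $w$, so on lines in the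
basis directions $F$ belongs to a quasi-analytic class and vanishes once it is flat at one point.
Flatness is given at $0$ for $\mathcal P$, and follows on the interior of $\overline E$ for
exponentials. Treating $T(p\,e_{i\lambda})$ for all polynomials $p$ at once allows moving along one
basis vector after another (`functional_eq_zero_of_polyExp`).

The one-variable input is the uniqueness half of Denjoy–Carleman (`eq_zero_of_flat`), obtained from
a growth argument of Bang; Carleman's inequality converts divergence of the series of roots into
divergence of the series of ratios. Polynomial factors and the derivatives in $p_\alpha$ disturb the
moments; square roots of even moments and geometric factors absorb this (`exists_isQASeq`,
`IsQASeq.norm_iterD_le`). -/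

/-- The ratios of a log-convex sequence increase. -/
theorem ratio_le_of_logConvex {M : ℕ → ℝ} (hM : ∀ m, 0 < M m)
    (hc : ∀ m, M (m + 1) ^ 2 ≤ M m * M (m + 2)) {m k : ℕ} (hmk : m ≤ k) :
    M k / M (k + 1) ≤ M m / M (m + 1) := by
  have h : Antitone fun m => M m / M (m + 1) := antitone_nat_of_succ_le fun m => by
    rw [div_le_div_iff₀ (hM _) (hM _), ← sq]
    exact hc m
  exact h hmk

/-- A growth estimate of Bang: an exponentially weighted bound on all derivatives at a point
propagates, with the loss of a factor `e`, over a length governed by a ratio of the sequence. -/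
theorem bang_step {M : ℕ → ℝ} (hM : ∀ m, 0 < M m) (hc : ∀ m, M (m + 1) ^ 2 ≤ M m * M (m + 2))
    {f : ℕ → ℝ → ℂ} (hf : ∀ m t, HasDerivAt (f m) (f (m + 1) t) t) {R : ℝ}
    (hb : ∀ m, ∀ t ∈ Set.Icc 0 R, ‖f m t‖ ≤ M m) (K : ℕ) {a b : ℝ} (ha : 0 ≤ a) (hab : a ≤ b)
    (hbR : b ≤ R) (hs : b - a ≤ Real.exp (-1) * (M K / M (K + 1)))
    (h : ∀ m : ℕ, ‖f m a‖ ≤ Real.exp (m - (K + 1)) * M m) (m : ℕ) :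
    ‖f m b‖ ≤ Real.exp (m - K) * M m := by
  rcases le_or_gt K m with hm | hm
  · refine (hb m b ⟨ha.trans hab, hbR⟩).trans (le_mul_of_one_le_left (hM m).le ?_)
    exact Real.one_le_exp (sub_nonneg.2 (by exact_mod_cast hm))
  -- The rate `c` is the reciprocal of the maximal length of the interval, so the majorants below
  -- grow by at most a factor `e` from `a` to `b`.
  set c : ℝ := Real.exp 1 * (M (K + 1) / M K) with hcdef
  have hc0 : 0 < c := mul_pos (Real.exp_pos _) (div_pos (hM _) (hM _))
  -- Induction downwards from order `K + 1`, where `hb` suffices. At lower order the hypothesis at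
  -- `a` gives the initial value, and the bound one order higher is at most the derivative of the
  -- majorant, since `M (i + 1) / M i ≤ M (K + 1) / M K`.
  have key : ∀ j : ℕ, j ≤ K + 1 → ∀ t ∈ Set.Icc a b,
      ‖f (K + 1 - j) t‖ ≤ Real.exp (-j) * M (K + 1 - j) * Real.exp (c * (t - a)) := by
    intro j
    induction j with
    | zero =>
      intro _ t ht
      have h1 := hb (K + 1) t ⟨ha.trans ht.1, ht.2.trans hbR⟩
      simp only [Nat.cast_zero, neg_zero, Real.exp_zero, one_mul, Nat.sub_zero]
      exact h1.trans (le_mul_of_one_le_right (hM _).le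
        (Real.one_le_exp (mul_nonneg hc0.le (sub_nonneg.2 ht.1))))
    | succ j ih =>
      intro hj t ht
      have hj' : K + 1 - j = (K + 1 - (j + 1)) + 1 := by omega
      have ih' := ih (by omega)
      set i := K + 1 - (j + 1) with hi
      rw [hj'] at ih'
      have hBd : ∀ x, HasDerivAt
          (fun x => Real.exp (-((j + 1 : ℕ) : ℝ)) * M i * Real.exp (c * (x - a)))
          (Real.exp (-((j + 1 : ℕ) : ℝ)) * M i * (Real.exp (c * (x - a)) * c)) x := by
        intro x
        have := (((hasDerivAt_id x).sub_const a).const_mul c).exp.const_mul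
          (Real.exp (-((j + 1 : ℕ) : ℝ)) * M i)
        simpa using this
      refine image_norm_le_of_norm_deriv_right_le_deriv_boundary (f := f i) (f' := f (i + 1))
        (B' := fun x => Real.exp (-((j + 1 : ℕ) : ℝ)) * M i * (Real.exp (c * (x - a)) * c))
        (fun x _ => (hf i x).continuousAt.continuousWithinAt)
        (fun x _ => (hf i x).hasDerivWithinAt) ?_ hBd ?_ ht
      · have h1 := h i
        have h2 : (i : ℝ) - (K + 1) = -((j + 1 : ℕ) : ℝ) := by
          rw [hi, Nat.cast_sub hj]; push_cast; ring
        rw [h2] at h1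
        simpa using h1
      · intro x hx
        refine (ih' x ⟨hx.1, hx.2.le⟩).trans ?_
        have h3 := ratio_le_of_logConvex hM hc (show i ≤ K by omega)
        rw [div_le_div_iff₀ (hM _) (hM _)] at h3
        have h4 : M (i + 1) ≤ M i * (M (K + 1) / M K) := by
          rw [mul_div_assoc', le_div_iff₀ (hM K), mul_comm]
          exact h3
        have h5 : Real.exp (-(j : ℝ)) = Real.exp (-((j + 1 : ℕ) : ℝ)) * Real.exp 1 := by
          rw [← Real.exp_add]; congr 1; push_cast; ring
        rw [h5, hcdef]
        calc Real.exp (-((j + 1 : ℕ) : ℝ)) * Real.exp 1 * M (i + 1) *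
              Real.exp (Real.exp 1 * (M (K + 1) / M K) * (x - a))
            ≤ Real.exp (-((j + 1 : ℕ) : ℝ)) * Real.exp 1 * (M i * (M (K + 1) / M K)) *
              Real.exp (Real.exp 1 * (M (K + 1) / M K) * (x - a)) := by gcongr
          _ = _ := by ring
  have h1 := key (K + 1 - m) (by omega) b ⟨hab, le_rfl⟩
  rw [show K + 1 - (K + 1 - m) = m by omega] at h1
  refine h1.trans ?_
  have h2 : c * (b - a) ≤ 1 := by
    calc c * (b - a) ≤ c * (Real.exp (-1) * (M K / M (K + 1))) := by gcongr
      _ = 1 := by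
        rw [hcdef, Real.exp_neg]
        have := (hM K).ne'
        have := (hM (K + 1)).ne'
        have := (Real.exp_pos 1).ne'
        field_simp
  have h3 : Real.exp (m - K) = Real.exp (-((K + 1 - m : ℕ) : ℝ)) * Real.exp 1 := by
    rw [← Real.exp_add, Nat.cast_sub (by omega)]; congr 1; push_cast; ring
  rw [h3, mul_right_comm]
  have := hM m
  gcongr

/-- The uniqueness half of the Denjoy–Carleman theorem. -/
theorem eq_zero_of_flat {M : ℕ → ℝ} (hM : ∀ m, 0 < M m)
    (hc : ∀ m, M (m + 1) ^ 2 ≤ M m * M (m + 2)) (hsum : ¬ Summable fun m => M m / M (m + 1))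
    {f : ℕ → ℝ → ℂ} (hf : ∀ m t, HasDerivAt (f m) (f (m + 1) t) t) {R : ℝ}
    (hb : ∀ m, ∀ t ∈ Set.Icc 0 R, ‖f m t‖ ≤ M m) (h0 : ∀ m, f m 0 = 0) :
    ∀ t ∈ Set.Icc 0 R, f 0 t = 0 := by
  have hpos : ∀ m, 0 ≤ M m / M (m + 1) := fun m => (div_pos (hM _) (hM _)).le
  -- A chain of `j` applications of `bang_step` descends from level `K + j` at `0`, where flatness
  -- makes every level available, to level `K` at `t`.
  have chain : ∀ j K : ℕ, ∀ t ∈ Set.Icc 0 R,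
      t ≤ Real.exp (-1) * ∑ i ∈ Finset.range j, M (K + i) / M (K + i + 1) →
      ∀ m : ℕ, ‖f m t‖ ≤ Real.exp (m - K) * M m := by
    intro j
    induction j with
    | zero =>
      intro K t ht hts m
      have : t = 0 := le_antisymm (by simpa using hts) ht.1
      rw [this, h0, norm_zero]
      exact mul_nonneg (Real.exp_pos _).le (hM m).le
    | succ j ih =>
      intro K t ht hts
      set S := Real.exp (-1) * ∑ i ∈ Finset.range j, M (K + 1 + i) / M (K + 1 + i + 1) with hS
      have hS0 : 0 ≤ S :=
        mul_nonneg (Real.exp_pos _).le (Finset.sum_nonneg fun i _ => hpos _)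
      have hts' : t ≤ S + Real.exp (-1) * (M K / M (K + 1)) := by
        rw [Finset.sum_range_succ', mul_add] at hts
        simpa [hS, add_assoc, add_comm, add_left_comm] using hts
      -- The last step starts at `min t S`, because `t` may already be within reach at level `K +
      -- 1`.
      have hmin : min t S ∈ Set.Icc 0 R := ⟨le_min ht.1 hS0, (min_le_left _ _).trans ht.2⟩
      refine bang_step hM hc hf hb K hmin.1 (min_le_left _ _) ht.2 ?_ fun m => ?_
      · rcases min_cases t S with h | h
        · rw [h.1, sub_self]
          exact mul_nonneg (Real.exp_pos _).le (hpos _)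
        · rw [h.1]; linarith
      · have := ih (K + 1) (min t S) hmin (min_le_right _ _) m
        simpa using this
  intro t ht
  have hK : ∀ K : ℕ, ‖f 0 t‖ ≤ Real.exp (-K) * M 0 := by
    intro K
    -- Every tail of the ratio series diverges, so `t` can be reached at any level `K`; letting `K`
    -- grow makes the bound `exp (-K) * M 0` vanish.
    have hdiv : Filter.Tendsto (fun j => ∑ i ∈ Finset.range j, M (K + i) / M (K + i + 1))
        Filter.atTop Filter.atTop := by
      rw [← not_summable_iff_tendsto_nat_atTop_of_nonneg fun i => hpos _]
      intro h
      refine hsum ((summable_nat_add_iff K).1 ?_)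
      simpa only [add_comm K, add_right_comm] using h
    obtain ⟨j, hj⟩ := (hdiv.eventually_ge_atTop (t * Real.exp 1)).exists
    have := chain j K t ht ?_ 0
    · simpa using this
    · calc t = Real.exp (-1) * (t * Real.exp 1) := by
            rw [Real.exp_neg]; field_simp
        _ ≤ _ := by gcongr
  have hlim : Filter.Tendsto (fun K : ℕ => Real.exp (-K) * M 0) Filter.atTop (𝓝 (0 * M 0)) :=
    (Real.tendsto_exp_neg_atTop_nhds_zero.comp tendsto_natCast_atTop_atTop).mul_const _
  rw [zero_mul] at hlim
  exact norm_le_zero_iff.1 (ge_of_tendsto' hlim hK)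

/-! ### Carleman's inequality and log-convex sequences -/

/-- A single term of the exponential series gives $m^m/m!\le e^m$. -/
theorem exp_neg_mul_rpow_le_factorial (m : ℕ) (hm : 0 < m) :
    (m : ℝ) * Real.exp (-1) ≤ (m.factorial : ℝ) ^ ((m : ℝ)⁻¹) := by
  have hm' : (0 : ℝ) < m := by exact_mod_cast hm
  rw [Real.le_rpow_inv_iff_of_pos (by positivity) (by positivity) hm', Real.rpow_natCast, mul_pow,
    ← Real.exp_nat_mul]
  have h := Real.pow_div_factorial_le_exp (m : ℝ) hm'.le m
  rw [div_le_iff₀ (by positivity)] at h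
  rw [mul_neg_one, Real.exp_neg, ← div_eq_mul_inv, div_le_iff₀ (Real.exp_pos _), mul_comm]
  exact h

/-- The inequality of arithmetic and geometric means with the weights `1, 2, …, m`. -/
theorem prod_rpow_inv_le {a : ℕ → ℝ} (ha : ∀ k, 0 ≤ a k) (m : ℕ) (hm : 0 < m) :
    (∏ k ∈ Finset.range m, a k) ^ ((m : ℝ)⁻¹) ≤
      Real.exp 1 * ((∑ k ∈ Finset.range m, ((k : ℝ) + 1) * a k) / (m : ℝ) ^ 2) := by
  have hm' : (0 : ℝ) < m := by exact_mod_cast hm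
  have h1 : (∏ k ∈ Finset.range m, (((k : ℝ) + 1) * a k)) ^ ((m : ℝ)⁻¹) ≤
      (∑ k ∈ Finset.range m, ((k : ℝ) + 1) * a k) / m := by
    have := Real.geom_mean_le_arith_mean (Finset.range m) (fun _ => (1 : ℝ))
      (fun k => ((k : ℝ) + 1) * a k) (by simp) (by simpa using hm)
      (fun k _ => mul_nonneg (by positivity) (ha k))
    simpa using this
  rw [Finset.prod_mul_distrib] at h1
  have h2 : (∏ k ∈ Finset.range m, ((k : ℝ) + 1)) = m.factorial := by
    rw [← Finset.prod_range_add_one_eq_factorial]; push_cast; rfl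
  rw [h2, Real.mul_rpow (by positivity) (Finset.prod_nonneg fun k _ => ha k)] at h1
  have h3 := exp_neg_mul_rpow_le_factorial m hm
  have h4 : 0 ≤ (∏ k ∈ Finset.range m, a k) ^ ((m : ℝ)⁻¹) :=
    Real.rpow_nonneg (Finset.prod_nonneg fun k _ => ha k) _
  have h5 := (mul_le_mul_of_nonneg_right h3 h4).trans h1
  rw [Real.exp_neg] at h5
  rw [le_div_iff₀ hm'] at h5
  rw [mul_div_assoc', le_div_iff₀ (by positivity)]
  have h6 := mul_le_mul_of_nonneg_left h5 (Real.exp_pos 1).le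
  calc _ = Real.exp 1 * (m * (Real.exp 1)⁻¹ *
        (∏ k ∈ Finset.range m, a k) ^ ((m : ℝ)⁻¹) * m) := by
        field_simp
    _ ≤ _ := h6

theorem sum_inv_sq_le (k N : ℕ) :
    ∑ m ∈ Finset.Ico k N, 1 / ((m : ℝ) + 1) ^ 2 ≤ 2 / ((k : ℝ) + 1) := by
  rcases le_or_gt N k with h | h
  · rw [Finset.Ico_eq_empty_of_le h]; simp; positivity
  -- Subtracting `1 / N` makes the induction close: $1/(N+1)^2\le 1/N-1/(N+1)$.
  have key : ∀ N, k < N → ∑ m ∈ Finset.Ico k N, 1 / ((m : ℝ) + 1) ^ 2 ≤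
      2 / ((k : ℝ) + 1) - 1 / N := by
    intro N hN
    induction N, hN using Nat.le_induction with
    | base =>
      simp only [Nat.Ico_succ_singleton, Finset.sum_singleton, Nat.succ_eq_add_one]
      push_cast
      rw [div_sub_div_same, div_le_div_iff₀ (by positivity) (by positivity)]
      nlinarith [(Nat.cast_nonneg k : (0 : ℝ) ≤ k)]
    | succ N hN ih =>
      have hN0 : (0 : ℝ) < N := by exact_mod_cast (Nat.zero_lt_of_lt hN)
      rw [Finset.sum_Ico_succ_top (by omega)]
      have : 1 / ((N : ℝ) + 1) ^ 2 ≤ 1 / (N : ℝ) - 1 / (N + 1) := by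
        rw [div_sub_div _ _ hN0.ne' (by positivity), div_le_div_iff₀ (by positivity) (by positivity)]
        nlinarith
      push_cast
      linarith
  have := key N h
  have : (0 : ℝ) ≤ 1 / N := by positivity
  linarith

/-- Carleman's inequality, with the constant `2 e`. -/
theorem carleman_inequality {a : ℕ → ℝ} (ha : ∀ k, 0 ≤ a k) (N : ℕ) :
    ∑ m ∈ Finset.range N, (∏ k ∈ Finset.range (m + 1), a k) ^ (((m : ℝ) + 1)⁻¹) ≤
      2 * Real.exp 1 * ∑ k ∈ Finset.range N, a k := by
  calc _ ≤ ∑ m ∈ Finset.range N, Real.exp 1 *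
          ((∑ k ∈ Finset.range (m + 1), ((k : ℝ) + 1) * a k) / ((m : ℝ) + 1) ^ 2) := by
        refine Finset.sum_le_sum fun m _ => ?_
        have := prod_rpow_inv_le ha (m + 1) (Nat.succ_pos m)
        push_cast at this
        exact this
    _ = Real.exp 1 * ∑ m ∈ Finset.range N, ∑ k ∈ Finset.range (m + 1),
          (((k : ℝ) + 1) * a k) * (1 / ((m : ℝ) + 1) ^ 2) := by
        rw [← Finset.mul_sum]
        congr 1
        refine Finset.sum_congr rfl fun m _ => ?_
        rw [Finset.sum_div]
        exact Finset.sum_congr rfl fun k _ => by ring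
    _ = Real.exp 1 * ∑ k ∈ Finset.range N, ∑ m ∈ Finset.Ico k N,
          (((k : ℝ) + 1) * a k) * (1 / ((m : ℝ) + 1) ^ 2) := by
        congr 1
        refine Finset.sum_comm' fun m k => ?_
        simp only [Finset.mem_range, Finset.mem_Ico]
        omega
    _ ≤ Real.exp 1 * ∑ k ∈ Finset.range N, 2 * a k := by
        gcongr with k _
        rw [← Finset.mul_sum]
        calc _ ≤ (((k : ℝ) + 1) * a k) * (2 / ((k : ℝ) + 1)) :=
              mul_le_mul_of_nonneg_left (sum_inv_sq_le k N) (mul_nonneg (by positivity) (ha k))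
          _ = 2 * a k := by field_simp
    _ = _ := by rw [← Finset.mul_sum]; ring

/-- Carleman's inequality applied to the ratios: their products telescope to `A 0 / A (m + 1)`,
which dominates `1 / A (m + 1)` because `A 0 ≥ 1`. -/
theorem not_summable_ratio {A : ℕ → ℝ} (hA : ∀ m, 1 ≤ A m)
    (hs : ¬ Summable fun m : ℕ => A (m + 1) ^ (-(((m : ℝ) + 1)⁻¹))) :
    ¬ Summable fun m => A m / A (m + 1) := by
  have hA0 : ∀ m, 0 < A m := fun m => one_pos.trans_le (hA m)
  intro h
  refine hs (summable_of_sum_range_le (c := 2 * Real.exp 1 * ∑' k, A k / A (k + 1))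
    (fun m => Real.rpow_nonneg (hA0 _).le _) fun N => ?_)
  have hprod : ∀ m, ∏ k ∈ Finset.range (m + 1), A k / A (k + 1) = A 0 / A (m + 1) := by
    intro m
    induction m with
    | zero => simp
    | succ m ih => rw [Finset.prod_range_succ, ih, div_mul_div_cancel₀ (hA0 _).ne']
  refine le_trans (Finset.sum_le_sum fun m _ => ?_)
    ((carleman_inequality (fun k => (div_pos (hA0 k) (hA0 (k + 1))).le) N).trans ?_)
  · rw [hprod, Real.rpow_neg (hA0 _).le, ← Real.inv_rpow (hA0 _).le]
    refine Real.rpow_le_rpow (inv_nonneg.2 (hA0 _).le) ?_ (by positivity)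
    rw [inv_eq_one_div]
    exact div_le_div_of_nonneg_right (hA 0) (hA0 _).le
  · exact mul_le_mul_of_nonneg_left
      (h.sum_le_tsum _ fun k _ => (div_pos (hA0 k) (hA0 (k + 1))).le) (by positivity)

/-- Passing to the square roots of every second term keeps a log-convex sequence
quasi-analytic. -/
theorem not_summable_ratio_sqrt {A : ℕ → ℝ} (hA : ∀ m, 0 < A m)
    (hc : ∀ m, A (m + 1) ^ 2 ≤ A m * A (m + 2)) (hs : ¬ Summable fun m => A m / A (m + 1)) :
    ¬ Summable fun m => √(A (2 * m)) / √(A (2 * (m + 1))) := by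
  intro h
  have hr : ∀ m, 0 ≤ A m / A (m + 1) := fun m => (div_pos (hA _) (hA _)).le
  -- A ratio at an odd index is at most the geometric mean of itself and the preceding ratio, which
  -- is $\sqrt{A_{2m}/A_{2m+2}}$. The remaining ratios are then dominated by monotonicity.
  have h1 : Summable fun m => A (2 * m + 1) / A (2 * m + 1 + 1) := by
    refine h.of_nonneg_of_le (fun m => hr _) fun m => ?_
    rw [← Real.sqrt_div (hA _).le]
    refine Real.le_sqrt_of_sq_le ?_
    calc (A (2 * m + 1) / A (2 * m + 1 + 1)) ^ 2
        = A (2 * m + 1) / A (2 * m + 1 + 1) * (A (2 * m + 1) / A (2 * m + 1 + 1)) := sq _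
      _ ≤ A (2 * m) / A (2 * m + 1) * (A (2 * m + 1) / A (2 * m + 1 + 1)) :=
        mul_le_mul_of_nonneg_right (ratio_le_of_logConvex hA hc (by omega)) (hr _)
      _ = A (2 * m) / A (2 * (m + 1)) := by
        rw [div_mul_div_cancel₀ (hA _).ne']; rfl
  have h2 : Summable fun m => A (2 * m + 2) / A (2 * m + 2 + 1) :=
    h1.of_nonneg_of_le (fun m => hr _) fun m => ratio_le_of_logConvex hA hc (by omega)
  refine hs ((summable_nat_add_iff 1).1 (Summable.even_add_odd (f := fun m => A (m + 1) / A (m + 1 + 1)) ?_ ?_))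
  · exact h1
  · exact h2


/-! ### Iterated partial derivatives -/

theorem partialD_apply {n : ℕ} (j : Fin n) (f : smooth n) (x : Rn n) :
    (partialD j f).1 x = fderiv ℝ f.1 x (EuclideanSpace.single j 1) := rfl

theorem partialD_comm {n : ℕ} (j k : Fin n) :
    Commute (partialD j : Module.End ℂ (smooth n)) (partialD k) := by
  have key : ∀ (j k : Fin n) (f : smooth n) (x : Rn n), (partialD j (partialD k f)).1 x =
      fderiv ℝ (fderiv ℝ f.1) x (EuclideanSpace.single j 1) (EuclideanSpace.single k 1) := by
    intro j k f x
    have hd : DifferentiableAt ℝ (fderiv ℝ f.1) x :=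
      ((smooth.contDiff f).fderiv_right (m := ∞) (by simp)).differentiable (by simp) x
    have : HasFDerivAt (fun y => fderiv ℝ f.1 y (EuclideanSpace.single k 1))
        ((ContinuousLinearMap.apply ℝ ℂ (EuclideanSpace.single k (1 : ℝ))).comp
          (fderiv ℝ (fderiv ℝ f.1) x)) x :=
      (ContinuousLinearMap.apply ℝ ℂ (EuclideanSpace.single k (1 : ℝ))).hasFDerivAt.comp x
        hd.hasFDerivAt
    rw [partialD_apply]
    change fderiv ℝ (fun y => fderiv ℝ f.1 y (EuclideanSpace.single k 1)) x _ = _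
    rw [this.fderiv]
    rfl
  refine LinearMap.ext fun f => Subtype.ext (funext fun x => ?_)
  change (partialD j (partialD k f)).1 x = (partialD k (partialD j f)).1 x
  rw [key, key]
  have hs : IsSymmSndFDerivAt ℝ f.1 x :=
    (smooth.contDiff f).contDiffAt.isSymmSndFDerivAt (by
      rw [minSmoothness_of_isRCLikeNormedField]
      exact WithTop.coe_le_coe.2 (show (2 : ℕ∞) ≤ ⊤ from le_top))
  exact hs _ _

/-- The operator `∂_{l₁} ∂_{l₂} ⋯` for a list `l` of indices. -/
def iterD {n : ℕ} (l : List (Fin n)) : Module.End ℂ (smooth n) := (l.map partialD).prod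

theorem iterD_nil {n : ℕ} (f : smooth n) : iterD [] f = f := rfl

theorem iterD_append {n : ℕ} (l l' : List (Fin n)) (f : smooth n) :
    iterD (l ++ l') f = iterD l (iterD l' f) := by
  simp [iterD, Module.End.mul_apply]

theorem iterD_singleton {n : ℕ} (j : Fin n) (f : smooth n) : iterD [j] f = partialD j f := by
  simp [iterD]

theorem iterD_concat {n : ℕ} (l : List (Fin n)) (j : Fin n) (f : smooth n) :
    iterD (l ++ [j]) f = iterD l (partialD j f) := by
  rw [iterD_append, iterD_singleton]

/-- The list of indices in which `j` occurs `α j` times. -/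
def multiList {n : ℕ} (α : Fin n → ℕ) : List (Fin n) :=
  (List.ofFn fun j => List.replicate (α j) j).flatten

theorem multiD_eq_iterD {n : ℕ} (α : Fin n → ℕ) : multiD α = iterD (multiList α) := by
  rw [multiD, iterD, multiList, List.map_flatten, List.prod_flatten, List.map_map, List.map_ofFn]
  congr 1
  rw [List.ofFn_inj]
  funext j
  simp

/-- Partial derivatives commute, so only multiplicities count. Lists replace multi-indices from here
on because they allow induction on one derivative at a time. -/
theorem iterD_eq_multiD {n : ℕ} (l : List (Fin n)) : iterD l = multiD fun j => l.count j := by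
  have hp : List.Perm l (multiList fun j => l.count j) := by
    rw [List.perm_iff_count]
    intro j
    rw [multiList, List.count_flatten, List.map_ofFn, List.sum_ofFn]
    simp [List.count_replicate]
  rw [multiD_eq_iterD]
  refine (hp.map partialD).prod_eq' ?_
  refine List.Pairwise.map partialD (fun a b _ => partialD_comm a b) (R := fun _ _ => True) ?_
  exact List.pairwise_of_forall fun _ _ => trivial

theorem mem_cwSub_iff {n : ℕ} (w : Weight n) (f : smooth n) : f ∈ cwSub w ↔
    ∀ l : List (Fin n),
      Filter.Tendsto (fun x => (iterD l f).1 x * (w x : ℂ)) (Filter.cocompact (Rn n)) (𝓝 0) := by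
  refine ⟨fun h l => ?_, fun h α => ?_⟩
  · rw [iterD_eq_multiD]; exact h _
  · rw [multiD_eq_iterD]; exact h _

theorem partialD_mem_cwSub {n : ℕ} {w : Weight n} {f : smooth n} (hf : f ∈ cwSub w) (j : Fin n) :
    partialD j f ∈ cwSub w := by
  rw [mem_cwSub_iff] at hf ⊢
  intro l
  rw [← iterD_concat]
  exact hf _

/-! ### Products, polynomials and exponentials -/

/-- The product of two smooth functions. -/
def smooth.mul {n : ℕ} (f g : smooth n) : smooth n :=
  ⟨fun x => f.1 x * g.1 x, (smooth.contDiff f).mul (smooth.contDiff g)⟩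

theorem smooth.mul_apply {n : ℕ} (f g : smooth n) (x : Rn n) :
    (smooth.mul f g).1 x = f.1 x * g.1 x := rfl

theorem smooth.ext' {n : ℕ} {f g : smooth n} (h : ∀ x, f.1 x = g.1 x) : f = g :=
  Subtype.ext (funext h)

theorem partialD_mul {n : ℕ} (j : Fin n) (f g : smooth n) : partialD j (smooth.mul f g) =
    smooth.mul (partialD j f) g + smooth.mul f (partialD j g) := by
  refine smooth.ext' fun x => ?_
  rw [partialD_apply]
  change fderiv ℝ (fun x => f.1 x * g.1 x) x _ = fderiv ℝ f.1 x _ * g.1 x + f.1 x * fderiv ℝ g.1 x _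
  rw [fderiv_fun_mul (smooth.differentiableAt f x) (smooth.differentiableAt g x)]
  simp
  ring

theorem hasFDerivAt_coord {n : ℕ} (j : Fin n) (x : Rn n) :
    HasFDerivAt (fun x : Rn n => (x j : ℂ))
      (Complex.ofRealCLM.comp (EuclideanSpace.proj (𝕜 := ℝ) j)) x :=
  (Complex.ofRealCLM.comp (EuclideanSpace.proj (𝕜 := ℝ) j : Rn n →L[ℝ] ℝ)).hasFDerivAt

theorem partialD_expFun {n : ℕ} (j : Fin n) (z : Cn n) :
    partialD j (expFun z) = (Complex.I * z j) • expFun z := by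
  refine smooth.ext' fun x => ?_
  have h : HasFDerivAt (fun x : Rn n => ∑ k, z k * (x k : ℂ))
      (∑ k, z k • Complex.ofRealCLM.comp (EuclideanSpace.proj (𝕜 := ℝ) k)) x :=
    HasFDerivAt.fun_sum fun k _ => (hasFDerivAt_coord k x).const_mul (z k)
  have h2 := (h.const_mul Complex.I).cexp
  rw [partialD_apply]
  change fderiv ℝ (fun x : Rn n => Complex.exp (Complex.I * ∑ k, z k * (x k : ℂ))) x _ =
    (Complex.I * z j) * Complex.exp (Complex.I * ∑ k, z k * (x k : ℂ))
  rw [h2.fderiv]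
  simp [apply_ite (Complex.ofReal)]
  ring

theorem polyMap_apply {n : ℕ} (p : MvPolynomial (Fin n) ℂ) (x : Rn n) :
    (polyMap n p).1 x = MvPolynomial.eval (fun j => (x j : ℂ)) p := rfl

theorem partialD_polyMap {n : ℕ} (j : Fin n) (p : MvPolynomial (Fin n) ℂ) :
    partialD j (polyMap n p) = polyMap n (MvPolynomial.pderiv j p) := by
  induction p using MvPolynomial.induction_on with
  | C a =>
    refine smooth.ext' fun x => ?_
    have : (polyMap n (MvPolynomial.C a)).1 = fun _ => a := by
      funext y; simp [polyMap_apply]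
    rw [partialD_apply, this]
    simp
  | add p q hp hq => simp [hp, hq]
  | mul_X p k hp =>
    have h1 : ∀ q : MvPolynomial (Fin n) ℂ, polyMap n (q * MvPolynomial.X k) =
        smooth.mul (polyMap n q) (polyMap n (MvPolynomial.X k)) := fun q =>
      smooth.ext' fun x => by simp [smooth.mul_apply, polyMap_apply]
    have h2 : ∀ x, (partialD j (polyMap n (MvPolynomial.X k))).1 x = if k = j then 1 else 0 := by
      intro x
      have : (polyMap n (MvPolynomial.X k)).1 = fun x : Rn n => (x k : ℂ) := by
        funext y; simp [polyMap_apply]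
      rw [partialD_apply, this, (hasFDerivAt_coord k x).fderiv]
      simp [apply_ite (Complex.ofReal)]
    rw [h1, partialD_mul, hp, ← h1]
    refine smooth.ext' fun x => ?_
    change (polyMap n _).1 x + (polyMap n p).1 x * _ = (polyMap n _).1 x
    rw [h2, polyMap_apply, polyMap_apply, polyMap_apply, MvPolynomial.pderiv_mul,
      MvPolynomial.pderiv_X, map_add, map_mul, map_mul, MvPolynomial.eval_X]
    by_cases h : k = j
    · simp [h]
    · simp [h]

/-- The function `p e_{iz}` for a polynomial `p`. -/
def polyExp {n : ℕ} (p : MvPolynomial (Fin n) ℂ) (z : Cn n) : smooth n :=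
  smooth.mul (polyMap n p) (expFun z)

theorem polyExp_apply {n : ℕ} (p : MvPolynomial (Fin n) ℂ) (z : Cn n) (x : Rn n) :
    (polyExp p z).1 x = MvPolynomial.eval (fun j => (x j : ℂ)) p *
      Complex.exp (Complex.I * ∑ j, z j * (x j : ℂ)) := rfl

theorem polyExp_one {n : ℕ} (z : Cn n) : polyExp 1 z = expFun z := by
  refine smooth.ext' fun x => ?_
  simp [polyExp_apply, expFun]

theorem polyExp_zero {n : ℕ} (p : MvPolynomial (Fin n) ℂ) : polyExp p 0 = polyMap n p := by
  refine smooth.ext' fun x => ?_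
  simp [polyExp_apply, polyMap_apply]

theorem polyExp_add {n : ℕ} (p q : MvPolynomial (Fin n) ℂ) (z : Cn n) :
    polyExp (p + q) z = polyExp p z + polyExp q z := by
  refine smooth.ext' fun x => ?_
  change _ = (polyExp p z).1 x + (polyExp q z).1 x
  simp [polyExp_apply, add_mul]

theorem polyExp_C_mul {n : ℕ} (c : ℂ) (p : MvPolynomial (Fin n) ℂ) (z : Cn n) :
    polyExp (MvPolynomial.C c * p) z = c • polyExp p z := by
  refine smooth.ext' fun x => ?_
  change _ = c * (polyExp p z).1 x
  simp [polyExp_apply, mul_assoc]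

theorem partialD_polyExp {n : ℕ} (j : Fin n) (p : MvPolynomial (Fin n) ℂ) (z : Cn n) :
    partialD j (polyExp p z) =
      polyExp (MvPolynomial.pderiv j p) z + (Complex.I * z j) • polyExp p z := by
  rw [polyExp, partialD_mul, partialD_polyMap, partialD_expFun]
  congr 1
  refine smooth.ext' fun x => ?_
  change (polyMap n p).1 x * ((Complex.I * z j) * (expFun z).1 x) =
    (Complex.I * z j) * ((polyMap n p).1 x * (expFun z).1 x)
  ring

/-- Polynomials times a fixed exponential are stable under each $\partial_j$, so membership in
$\mathcal C_w$ only requires decay of such products themselves. -/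
theorem iterD_polyExp {n : ℕ} (l : List (Fin n)) (p : MvPolynomial (Fin n) ℂ) (z : Cn n) :
    ∃ q, iterD l (polyExp p z) = polyExp q z := by
  induction l using List.reverseRecOn generalizing p with
  | nil => exact ⟨p, rfl⟩
  | append_singleton l j ih =>
    rw [iterD_concat, partialD_polyExp, ← polyExp_C_mul, ← polyExp_add]
    exact ih _

theorem iterD_expFun {n : ℕ} (l : List (Fin n)) (z : Cn n) :
    iterD l (expFun z) = (l.map fun j => Complex.I * z j).prod • expFun z := by
  induction l using List.reverseRecOn with
  | nil => simp [iterD_nil]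
  | append_singleton l j ih =>
    rw [iterD_concat, partialD_expFun, map_smul, ih, smul_smul]
    simp [mul_comm]

theorem norm_expFun_apply {n : ℕ} (z : Cn n) (x : Rn n) :
    ‖(expFun z).1 x‖ = Real.exp (-∑ j, (z j).im * x j) := by
  change ‖Complex.exp (Complex.I * ∑ j, z j * (x j : ℂ))‖ = _
  rw [Complex.norm_exp]
  simp

theorem norm_expFun_ofRn {n : ℕ} (z x : Rn n) : ‖(expFun (ofRn z)).1 x‖ = 1 := by
  rw [norm_expFun_apply]
  simp [ofRn]


/-! ### Vanishing at infinity -/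

theorem tendsto_cocompact_zero_iff {n : ℕ} {E : Type*} [NormedAddCommGroup E] (F : Rn n → E) :
    Filter.Tendsto F (Filter.cocompact (Rn n)) (𝓝 0) ↔
      ∀ ε > 0, ∃ R : ℝ, ∀ x, R ≤ ‖x‖ → ‖F x‖ ≤ ε := by
  rw [← Metric.cobounded_eq_cocompact, Filter.hasBasis_cobounded_norm.tendsto_iff
    Metric.nhds_basis_closedBall]
  simp

/-! ### The Schwartz space inside `C_w` -/

/-- Iterated partial derivatives as operators on the Schwartz space. -/
def schwartzD {n : ℕ} (l : List (Fin n)) : 𝓢(Rn n, ℂ) →L[ℂ] 𝓢(Rn n, ℂ) :=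
  (l.map fun j => LineDeriv.lineDerivOpCLM ℂ 𝓢(Rn n, ℂ)
    (EuclideanSpace.single j (1 : ℝ) : Rn n)).prod

theorem schwartzD_cons {n : ℕ} (j : Fin n) (l : List (Fin n)) (f : 𝓢(Rn n, ℂ)) :
    schwartzD (j :: l) f =
      LineDeriv.lineDerivOp (EuclideanSpace.single j (1 : ℝ) : Rn n) (schwartzD l f) := by
  simp [schwartzD]

theorem iterD_schwartzIncl {n : ℕ} (l : List (Fin n)) (f : 𝓢(Rn n, ℂ)) :
    iterD l (schwartzIncl n f) = schwartzIncl n (schwartzD l f) := by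
  induction l with
  | nil => rfl
  | cons j l ih =>
    have : iterD (j :: l) (schwartzIncl n f) = partialD j (iterD l (schwartzIncl n f)) := by
      rw [← List.singleton_append, iterD_append, iterD_singleton]
    rw [this, ih, schwartzD_cons]
    refine smooth.ext' fun x => ?_
    exact (SchwartzMap.lineDerivOp_apply_eq_fderiv _ _ _).symm

theorem schwartzIncl_mem {n : ℕ} (w : Weight n) (f : 𝓢(Rn n, ℂ)) :
    schwartzIncl n f ∈ cwSub w := by
  rw [mem_cwSub_iff]
  intro l
  rw [iterD_schwartzIncl]
  obtain ⟨B, hB⟩ := w.bounded'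
  have h : Filter.Tendsto (schwartzD l f) (Filter.cocompact (Rn n)) (𝓝 0) :=
    SchwartzMap.tendsto_cocompact _
  refine h.zero_mul_isBoundedUnder_le (Filter.isBoundedUnder_of ⟨B, fun x => ?_⟩)
  simpa [abs_of_nonneg (w.nonneg' x)] using hB x

/-- The inclusion of the Schwartz space in `C_w`. -/
def Cw.ofSchwartz {n : ℕ} (w : Weight n) : 𝓢(Rn n, ℂ) →ₗ[ℂ] Cw w :=
  LinearMap.codRestrict (cwSub w) (schwartzIncl n) (schwartzIncl_mem w)

theorem Cw.incl_ofSchwartz {n : ℕ} (w : Weight n) (f : 𝓢(Rn n, ℂ)) :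
    Cw.incl w (Cw.ofSchwartz w f) = schwartzIncl n f := rfl

theorem Cw.p_le {n : ℕ} {w : Weight n} {α : Fin n → ℕ} {f : Cw w} {C : ℝ}
    (h : ∀ x, ‖(multiD α (Cw.incl w f)).1 x * (w x : ℂ)‖ ≤ C) : Cw.p w α f ≤ C :=
  ciSup_le h

theorem Cw.continuous_ofSchwartz {n : ℕ} (w : Weight n) : Continuous (Cw.ofSchwartz w) := by
  refine WithSeminorms.continuous_of_continuous_comp (Cw.withSeminorms w) _ fun α => ?_
  obtain ⟨B, hB⟩ := w.bounded'
  have hB0 : 0 ≤ B := (w.nonneg' 0).trans (hB 0)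
  set q : Seminorm ℂ 𝓢(Rn n, ℂ) := (B.toNNReal) •
    ((SchwartzMap.seminorm ℂ 0 0).comp (schwartzD (multiList α) : 𝓢(Rn n, ℂ) →ₗ[ℂ] 𝓢(Rn n, ℂ)))
    with hq
  have hqc : Continuous q := by
    have h1 : Continuous fun f : 𝓢(Rn n, ℂ) => SchwartzMap.seminorm ℂ 0 0 f :=
      (schwartz_withSeminorms ℂ (Rn n) ℂ).continuous_seminorm (0, 0)
    have h2 : Continuous fun f : 𝓢(Rn n, ℂ) => (B.toNNReal : ℝ) *
        SchwartzMap.seminorm ℂ 0 0 (schwartzD (multiList α) f) :=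
      (h1.comp (schwartzD (multiList α)).continuous).const_mul _
    exact h2
  refine Seminorm.continuous_of_le hqc fun f => ?_
  change Cw.p w α (Cw.ofSchwartz w f) ≤
    (B.toNNReal : ℝ) * SchwartzMap.seminorm ℂ 0 0 (schwartzD (multiList α) f)
  refine Cw.p_le fun x => ?_
  rw [Cw.incl_ofSchwartz, multiD_eq_iterD, iterD_schwartzIncl, norm_mul, mul_comm,
    Real.coe_toNNReal _ hB0, Complex.norm_real, Real.norm_of_nonneg (w.nonneg' x)]
  exact mul_le_mul (hB x) (SchwartzMap.norm_le_seminorm ℂ _ x) (norm_nonneg _) hB0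

/-! ### Cutoffs -/

/-- The dilation `x ↦ g (R⁻¹ x)`. -/
def dil {n : ℕ} (R : ℝ) (g : smooth n) : smooth n :=
  ⟨fun x => g.1 (R⁻¹ • x), (smooth.contDiff g).comp (contDiff_const_smul _)⟩

theorem partialD_dil {n : ℕ} (j : Fin n) (R : ℝ) (g : smooth n) :
    partialD j (dil R g) = ((R⁻¹ : ℝ) : ℂ) • dil R (partialD j g) := by
  refine smooth.ext' fun x => ?_
  change fderiv ℝ (fun x => g.1 (R⁻¹ • x)) x _ = ((R⁻¹ : ℝ) : ℂ) * fderiv ℝ g.1 (R⁻¹ • x) _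
  have h1 : HasFDerivAt (fun x : Rn n => R⁻¹ • x) (R⁻¹ • ContinuousLinearMap.id ℝ (Rn n)) x :=
    (R⁻¹ • ContinuousLinearMap.id ℝ (Rn n)).hasFDerivAt
  have h2 := (smooth.differentiableAt g (R⁻¹ • x)).hasFDerivAt.comp x h1
  have h3 := h2.fderiv
  rw [Function.comp_def] at h3
  rw [h3]
  simp

/-- All partial derivatives of `g` are bounded. -/
def BoundedDerivs {n : ℕ} (g : smooth n) : Prop :=
  ∀ l : List (Fin n), ∃ C : ℝ, ∀ x, ‖(iterD l g).1 x‖ ≤ C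

theorem BoundedDerivs.partial_deriv {n : ℕ} {g : smooth n} (hg : BoundedDerivs g) (j : Fin n) :
    BoundedDerivs (partialD j g) := fun l => by
  rw [← iterD_concat]
  exact hg _

theorem partialD_eq_zero_on_ball {n : ℕ} {g : smooth n} (hg : ∀ x : Rn n, ‖x‖ < 1 → g.1 x = 0)
    (j : Fin n) (x : Rn n) (hx : ‖x‖ < 1) : (partialD j g).1 x = 0 := by
  have h : g.1 =ᶠ[𝓝 x] fun _ => 0 := by
    filter_upwards [(isOpen_lt continuous_norm continuous_const).mem_nhds hx] with y hy
    exact hg y hy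
  rw [partialD_apply, h.fderiv_eq]
  simp

/-- Multiplication by a function that vanishes on a large ball, and whose derivatives are
controlled, is small on `C_w`. -/
theorem tendsto_dil_mul {n : ℕ} {w : Weight n} (l : List (Fin n)) {g f : smooth n}
    (hg : BoundedDerivs g) (hg0 : ∀ x : Rn n, ‖x‖ < 1 → g.1 x = 0) (hf : f ∈ cwSub w)
    {ε : ℝ} (hε : 0 < ε) : ∃ R₀ : ℝ, ∀ R ≥ R₀, ∀ x,
      ‖(iterD l (smooth.mul (dil R g) f)).1 x * (w x : ℂ)‖ ≤ ε := by
  induction l using List.reverseRecOn generalizing g f ε with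
  | nil =>
    obtain ⟨C, hC⟩ := hg []
    have hC0 : 0 ≤ C := (norm_nonneg _).trans (hC 0)
    have h := (mem_cwSub_iff w f).1 hf []
    rw [tendsto_cocompact_zero_iff] at h
    obtain ⟨R₀, hR₀⟩ := h (ε / (C + 1)) (by positivity)
    refine ⟨max R₀ 1, fun R hR x => ?_⟩
    have hRpos : 0 < R := one_pos.trans_le ((le_max_right _ _).trans hR)
    change ‖g.1 (R⁻¹ • x) * f.1 x * (w x : ℂ)‖ ≤ ε
    rcases lt_or_ge ‖x‖ R with hx | hx
    · rw [hg0 _ (by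
        rw [norm_smul, Real.norm_of_nonneg (by positivity), inv_mul_lt_iff₀ hRpos]
        simpa using hx)]
      simpa using hε.le
    · rw [mul_assoc, norm_mul]
      calc _ ≤ C * (ε / (C + 1)) :=
            mul_le_mul (hC _) (hR₀ x (((le_max_left _ _).trans hR).trans hx)) (norm_nonneg _) hC0
        _ ≤ ε := by
            rw [mul_div_assoc', div_le_iff₀ (by positivity)]
            nlinarith
  | append_singleton l j ih =>
    -- By the Leibniz rule, a derivative falling on the dilation replaces `g` by `∂_j g`, with a
    -- factor `R⁻¹ ≤ 1`; one falling on `f` keeps it in $\mathcal C_w$. Both products are covered by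
    -- the induction hypothesis, which is why `g` and `f` vary in it.
    obtain ⟨R₁, h₁⟩ := ih (hg.partial_deriv j) (partialD_eq_zero_on_ball hg0 j) hf (half_pos hε)
    obtain ⟨R₂, h₂⟩ := ih hg hg0 (partialD_mem_cwSub hf j) (half_pos hε)
    refine ⟨max 1 (max R₁ R₂), fun R hR x => ?_⟩
    have hR1 : 1 ≤ R := (le_max_left _ _).trans hR
    have hRR := (le_max_right _ _).trans hR
    have e : iterD (l ++ [j]) (smooth.mul (dil R g) f) =
        ((R⁻¹ : ℝ) : ℂ) • iterD l (smooth.mul (dil R (partialD j g)) f) +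
          iterD l (smooth.mul (dil R g) (partialD j f)) := by
      rw [iterD_concat, partialD_mul, map_add, partialD_dil, ← map_smul]
      congr 2
      refine smooth.ext' fun x => ?_
      exact mul_assoc _ _ _
    rw [e]
    change ‖(((R⁻¹ : ℝ) : ℂ) * (iterD l (smooth.mul (dil R (partialD j g)) f)).1 x +
      (iterD l (smooth.mul (dil R g) (partialD j f))).1 x) * (w x : ℂ)‖ ≤ ε
    rw [add_mul, mul_assoc]
    refine (norm_add_le _ _).trans ?_
    have a1 := h₁ R ((le_max_left _ _).trans hRR) x
    have a2 := h₂ R ((le_max_right _ _).trans hRR) x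
    rw [norm_mul]
    have a3 : ‖((R⁻¹ : ℝ) : ℂ)‖ ≤ 1 := by
      rw [Complex.norm_real, Real.norm_of_nonneg (by positivity)]
      exact inv_le_one_of_one_le₀ hR1
    calc _ ≤ 1 * (ε / 2) + ε / 2 := by gcongr
      _ = ε := by ring

/-- Such a function is Schwartz, so a Schwartz seminorm of each derivative is the bound. -/
theorem BoundedDerivs.of_hasCompactSupport {n : ℕ} {g : smooth n} (hg : HasCompactSupport g.1) :
    BoundedDerivs g := by
  intro l
  have e : schwartzIncl n (hg.toSchwartzMap g.2) = g := rfl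
  rw [← e, iterD_schwartzIncl]
  exact ⟨_, SchwartzMap.norm_le_seminorm ℂ _⟩

theorem BoundedDerivs.const_sub {n : ℕ} (one : smooth n) (hone : ∀ x, one.1 x = 1) {g : smooth n}
    (hg : BoundedDerivs g) : BoundedDerivs (one - g) := by
  intro l
  obtain ⟨C, hC⟩ := hg l
  have h1 : BoundedDerivs one := by
    intro l
    induction l using List.reverseRecOn with
    | nil => exact ⟨1, fun x => by rw [iterD_nil, hone]; simp⟩
    | append_singleton l j ih =>
      have : partialD j one = 0 := smooth.ext' fun x => by
        rw [partialD_apply, show one.1 = fun _ => 1 from funext hone]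
        simp
      refine ⟨0, fun x => ?_⟩
      rw [iterD_concat, this, map_zero]
      simp
  obtain ⟨D, hD⟩ := h1 l
  refine ⟨D + C, fun x => ?_⟩
  rw [map_sub]
  exact (norm_sub_le _ _).trans (add_le_add (hD x) (hC x))

theorem Cw.mem_closure_iff {n : ℕ} {w : Weight n} {A : Set (Cw w)} {f : Cw w} : f ∈ closure A ↔
    ∀ (s : Finset (Fin n → ℕ)), ∀ ε > 0, ∃ g ∈ A, ∀ α ∈ s, Cw.p w α (g - f) < ε := by
  rw [mem_closure_iff_nhds_basis ((Cw.withSeminorms w).hasBasis_ball (x := f))]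
  constructor
  · intro h s ε hε
    obtain ⟨g, hg, hgb⟩ := h (s, ε) hε
    refine ⟨g, hg, fun α hα => ?_⟩
    rw [Seminorm.mem_ball] at hgb
    exact (Seminorm.le_finset_sup_apply hα).trans_lt hgb
  · rintro h ⟨s, ε⟩ hε
    obtain ⟨g, hg, hgb⟩ := h s ε hε
    refine ⟨g, hg, ?_⟩
    rw [Seminorm.mem_ball]
    exact Seminorm.finset_sup_apply_lt hε hgb

/-- The Schwartz functions are dense in `C_w`. -/
theorem Cw.denseRange_ofSchwartz {n : ℕ} (w : Weight n) : DenseRange (Cw.ofSchwartz w) := by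
  intro f
  rw [Cw.mem_closure_iff]
  intro s ε hε
  -- The bump equals 1 on the unit ball, so the error of the cutoff at scale `R` is multiplication
  -- by a dilate of `one - b`, to which `tendsto_dil_mul` applies.
  let χ : ContDiffBump (0 : Rn n) := ⟨1, 2, one_pos, one_lt_two⟩
  let one : smooth n := ⟨fun _ => 1, show ContDiff ℝ ∞ _ from contDiff_const⟩
  let b : smooth n := ⟨fun x => (χ x : ℂ), Complex.ofRealCLM.contDiff.comp χ.contDiff⟩
  have hb : HasCompactSupport b.1 := χ.hasCompactSupport.comp_left (g := Complex.ofReal) rfl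
  have hg : BoundedDerivs (one - b) :=
    BoundedDerivs.const_sub one (fun _ => rfl) (.of_hasCompactSupport hb)
  have hg0 : ∀ x : Rn n, ‖x‖ < 1 → (one - b).1 x = 0 := by
    intro x hx
    change (1 : ℂ) - (χ x : ℂ) = 0
    rw [χ.one_of_mem_closedBall (by simpa using hx.le)]
    simp
  have key : ∃ R₀ : ℝ, ∀ R ≥ R₀, ∀ α ∈ s, ∀ x,
      ‖(multiD α (smooth.mul (dil R (one - b)) (Cw.incl w f))).1 x * (w x : ℂ)‖ ≤ ε / 2 := by
    choose R₀ hR₀ using fun α : Fin n → ℕ =>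
      tendsto_dil_mul (multiList α) hg hg0 (show Cw.incl w f ∈ cwSub w from f.2) (half_pos hε)
    obtain ⟨M, hM⟩ := (s.image R₀).bddAbove
    refine ⟨M, fun R hR α hα x => ?_⟩
    rw [multiD_eq_iterD]
    exact hR₀ α R ((hM (Finset.mem_coe.2 (Finset.mem_image_of_mem R₀ hα))).trans hR) x
  obtain ⟨R₀, hR₀⟩ := key
  set R := max R₀ 1
  have hR0 : R⁻¹ ≠ 0 := (inv_pos.2 (one_pos.trans_le (le_max_right _ _))).ne'
  have hc : HasCompactSupport (smooth.mul (dil R b) (Cw.incl w f)).1 := by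
    refine HasCompactSupport.mul_right (f := fun x => b.1 (R⁻¹ • x)) ?_
    exact hb.comp_homeomorph (Homeomorph.smulOfNeZero _ hR0)
  refine ⟨_, ⟨hc.toSchwartzMap (smooth.contDiff _), rfl⟩, fun α hα => ?_⟩
  refine lt_of_le_of_lt (Cw.p_le fun x => ?_) (half_lt_self hε)
  have e : Cw.incl w (Cw.ofSchwartz w (hc.toSchwartzMap (smooth.contDiff _)) - f) =
      -smooth.mul (dil R (one - b)) (Cw.incl w f) := by
    rw [map_sub, Cw.incl_ofSchwartz]
    refine smooth.ext' fun x => ?_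
    change b.1 (R⁻¹ • x) * (Cw.incl w f).1 x - (Cw.incl w f).1 x =
      -((1 - b.1 (R⁻¹ • x)) * (Cw.incl w f).1 x)
    ring
  rw [e, map_neg]
  change ‖-(multiD α (smooth.mul (dil R (one - b)) (Cw.incl w f))).1 x * (w x : ℂ)‖ ≤ ε / 2
  rw [neg_mul, norm_neg]
  exact hR₀ R (le_max_left _ _) α hα x

theorem IsDenseInSchwartz.le_cwSub {n : ℕ} {w : Weight n} {L : Submodule ℂ (smooth n)}
    (hL : IsDenseInSchwartz L) : L ≤ cwSub w := by
  obtain ⟨S, -, rfl⟩ := hL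
  rintro _ ⟨f, -, rfl⟩
  exact schwartzIncl_mem w f

/-- Dense subspaces of the Schwartz space are dense in `C_w`. -/
theorem IsDenseInSchwartz.dense {n : ℕ} {w : Weight n} {L : Submodule ℂ (smooth n)}
    (hL : IsDenseInSchwartz L) : Dense (Cw.restrict w L : Set (Cw w)) := by
  obtain ⟨S, hS, rfl⟩ := hL
  refine ((Cw.denseRange_ofSchwartz w).dense_image (Cw.continuous_ofSchwartz w) hS).mono ?_
  rintro _ ⟨f, hf, rfl⟩
  exact ⟨f, hf, rfl⟩


/-! ### Embedding `C_w` into Banach spaces -/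

/-- The Banach space of bounded functions on `ℝⁿ`. -/
abbrev BddFun (n : ℕ) : Type := lp (fun _ : Rn n => ℂ) ⊤

open Classical in
/-- A bounded function as an element of `BddFun n`. -/
def toBdd {n : ℕ} (F : Rn n → ℂ) : BddFun n :=
  if h : BddAbove (Set.range fun x => ‖F x‖) then ⟨F, memℓp_infty h⟩ else 0

theorem toBdd_apply {n : ℕ} {F : Rn n → ℂ} (h : BddAbove (Set.range fun x => ‖F x‖)) (x : Rn n) :
    toBdd F x = F x := by
  rw [toBdd, dif_pos h]

theorem toBdd_apply_of_le {n : ℕ} {F : Rn n → ℂ} {C : ℝ} (h : ∀ x, ‖F x‖ ≤ C) (x : Rn n) :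
    toBdd F x = F x :=
  toBdd_apply ⟨C, by rintro _ ⟨x, rfl⟩; exact h x⟩ x

theorem BddFun.norm_le {n : ℕ} {F : BddFun n} {C : ℝ} (h : ∀ x, ‖F x‖ ≤ C) : ‖F‖ ≤ C :=
  lp.norm_le_of_forall_le ((norm_nonneg _).trans (h 0)) h

theorem BddFun.ext {n : ℕ} {F G : BddFun n} (h : ∀ x, F x = G x) : F = G :=
  lp.ext (funext h)

/-- The tuple of the functions `∂^α f · w`, `α ∈ s`. -/
def embedFun {n : ℕ} (w : Weight n) (s : Finset (Fin n → ℕ)) (f : smooth n) : s → BddFun n :=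
  fun α => toBdd fun x => (multiD α.1 f).1 x * (w x : ℂ)

/-- An element of `cwSub w` as an element of `C_w`. -/
def Cw.of {n : ℕ} {w : Weight n} {f : smooth n} (hf : f ∈ cwSub w) : Cw w := ⟨f, hf⟩

theorem embedFun_apply {n : ℕ} {w : Weight n} (s : Finset (Fin n → ℕ)) {f : smooth n}
    (hf : f ∈ cwSub w) (α : s) (x : Rn n) :
    embedFun w s f α x = (multiD α.1 f).1 x * (w x : ℂ) :=
  toBdd_apply (Cw.bddAbove w α.1 (Cw.of hf)) x

theorem embedFun_incl_apply {n : ℕ} {w : Weight n} (s : Finset (Fin n → ℕ)) (f : Cw w)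
    (α : s) (x : Rn n) : embedFun w s (Cw.incl w f) α x =
      (multiD α.1 (Cw.incl w f)).1 x * (w x : ℂ) :=
  embedFun_apply s f.2 α x

/-- `embedFun` as a linear map on `C_w`. -/
def embed {n : ℕ} (w : Weight n) (s : Finset (Fin n → ℕ)) : Cw w →ₗ[ℂ] (s → BddFun n) where
  toFun f := embedFun w s (Cw.incl w f)
  map_add' f g := by
    refine funext fun α => BddFun.ext fun x => ?_
    change _ = embedFun w s (Cw.incl w f) α x + embedFun w s (Cw.incl w g) α x
    rw [embedFun_incl_apply, embedFun_incl_apply, embedFun_incl_apply, map_add, map_add,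
      ← add_mul]
    rfl
  map_smul' c f := by
    refine funext fun α => BddFun.ext fun x => ?_
    change _ = c * embedFun w s (Cw.incl w f) α x
    rw [embedFun_incl_apply, embedFun_incl_apply, map_smul, map_smul, ← mul_assoc]
    rfl

theorem embed_apply {n : ℕ} (w : Weight n) (s : Finset (Fin n → ℕ)) (f : Cw w) :
    embed w s f = embedFun w s (Cw.incl w f) := rfl

/-- Basic neighbourhoods involve finitely many $p_\alpha$, and each is bounded by the norm of the
corresponding component of the embedding. -/
theorem Cw.mem_closure_of_embed {n : ℕ} {w : Weight n} {A : Set (Cw w)} {f : Cw w}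
    (h : ∀ s, embed w s f ∈ closure (embed w s '' A)) : f ∈ closure A := by
  rw [Cw.mem_closure_iff]
  intro s ε hε
  obtain ⟨_, ⟨g, hg, rfl⟩, hgf⟩ := Metric.mem_closure_iff.1 (h s) (ε / 2) (half_pos hε)
  refine ⟨g, hg, fun α hα => lt_of_le_of_lt (Cw.p_le fun x => ?_) (half_lt_self hε)⟩
  rw [dist_comm, dist_eq_norm, ← map_sub] at hgf
  refine le_trans ?_ ((norm_le_pi_norm (embed w s (g - f)) ⟨α, hα⟩).trans hgf.le)
  have := lp.norm_apply_le_norm ENNReal.top_ne_zero (embed w s (g - f) ⟨α, hα⟩) x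
  rwa [embed_apply, embedFun_incl_apply] at this

/-- A consequence of the Hahn–Banach theorem. -/
theorem mem_closure_of_forall_functional {E : Type*} [NormedAddCommGroup E] [NormedSpace ℂ E]
    (V : Submodule ℂ E) (x : E) (h : ∀ T : E →L[ℂ] ℂ, (∀ v ∈ V, T v = 0) → T x = 0) :
    x ∈ closure (V : Set E) := by
  by_contra hx
  have hconv : Convex ℝ (closure (V : Set E)) := (V.restrictScalars ℝ).convex.closure
  obtain ⟨T, u, hu, hV⟩ :=
    RCLike.geometric_hahn_banach_point_closed (𝕜 := ℂ) hconv isClosed_closure hx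
  have hu0 : u < 0 := by simpa using hV 0 (subset_closure V.zero_mem)
  -- On a subspace, a nonzero real part could be rescaled to the excluded value `u`. Applying this
  -- to `I • v` as well kills the imaginary part.
  have hre : ∀ v ∈ V, (T v).re = 0 := by
    intro v hv
    by_contra hne
    have h1 := hV (((u / (T v).re : ℝ) : ℂ) • v) (subset_closure (V.smul_mem _ hv))
    rw [map_smul, smul_eq_mul, RCLike.re_eq_complex_re, Complex.re_ofReal_mul,
      div_mul_cancel₀ _ hne] at h1
    exact h1.false
  have hT : T x = 0 := h T fun v hv => by
    refine Complex.ext (hre v hv) ?_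
    have := hre (Complex.I • v) (V.smul_mem _ hv)
    rw [map_smul, smul_eq_mul] at this
    simpa using this
  rw [hT] at hu
  simp at hu
  linarith

/-- A subspace of `C_w` is dense if the functionals that vanish on it vanish on the Schwartz
space. -/
theorem dense_of_functional {n : ℕ} {w : Weight n} {L : Submodule ℂ (smooth n)}
    (hL : L ≤ cwSub w)
    (h : ∀ (s : Finset (Fin n → ℕ)) (T : (s → BddFun n) →L[ℂ] ℂ),
      (∀ g ∈ L, T (embedFun w s g) = 0) →
        ∀ f : 𝓢(Rn n, ℂ), T (embedFun w s (schwartzIncl n f)) = 0) :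
    Dense (Cw.restrict w L : Set (Cw w)) := by
  refine Dense.of_closure (Dense.mono ?_ (Cw.denseRange_ofSchwartz w))
  rintro _ ⟨f, rfl⟩
  refine Cw.mem_closure_of_embed fun s => ?_
  have := mem_closure_of_forall_functional ((Cw.restrict w L).map (embed w s))
    (embed w s (Cw.ofSchwartz w f)) fun T hT => h s T (fun g hg => ?_) f
  · simpa using this
  · exact hT _ ⟨Cw.of (hL hg), hg, rfl⟩

/-! ### Exponentials in `C_w` -/

theorem expFun_mem_cwSub {n : ℕ} {w : Weight n} {z : Cn n}
    (h : Filter.Tendsto (fun x => (expFun z).1 x * (w x : ℂ)) (Filter.cocompact (Rn n)) (𝓝 0)) :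
    expFun z ∈ cwSub w := by
  rw [mem_cwSub_iff]
  intro l
  rw [iterD_expFun]
  have := h.const_mul (l.map fun j => Complex.I * z j).prod
  rw [mul_zero] at this
  refine this.congr fun x => ?_
  exact (mul_assoc _ _ _).symm

theorem expFun_ofRn_mem_cwSub {n : ℕ} {w : Weight n} (hw : w.VanishesAtInfinity) (t : Rn n) :
    expFun (ofRn t) ∈ cwSub w := by
  refine expFun_mem_cwSub ?_
  rw [tendsto_zero_iff_norm_tendsto_zero]
  refine hw.congr fun x => ?_
  rw [norm_mul, norm_expFun_ofRn, one_mul, Complex.norm_real, Real.norm_of_nonneg (w.nonneg' x)]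

/-- The weighted exponential `e_{iz} w`. -/
def wExp {n : ℕ} (w : Weight n) (z : Cn n) : BddFun n :=
  toBdd fun x => (expFun z).1 x * (w x : ℂ)

theorem bddAbove_wExp {n : ℕ} {w : Weight n} {z : Cn n} (h : expFun z ∈ cwSub w) :
    BddAbove (Set.range fun x => ‖(expFun z).1 x * (w x : ℂ)‖) := by
  have := Cw.bddAbove w 0 (Cw.of h)
  rw [multiD_eq_iterD] at this
  have h0 : multiList (0 : Fin n → ℕ) = [] := by
    rw [multiList, List.flatten_eq_nil_iff]
    simp
  rw [h0] at this
  exact this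

theorem wExp_apply {n : ℕ} {w : Weight n} {z : Cn n} (h : expFun z ∈ cwSub w) (x : Rn n) :
    wExp w z x = (expFun z).1 x * (w x : ℂ) :=
  toBdd_apply (bddAbove_wExp h) x

/-- All components are polynomial multiples in `z` of the single vector `wExp w z`, so continuity
and holomorphy in `z` need only be proved for the latter. -/
theorem embedFun_expFun {n : ℕ} {w : Weight n} (s : Finset (Fin n → ℕ)) {z : Cn n}
    (h : expFun z ∈ cwSub w) (α : s) : embedFun w s (expFun z) α =
      ((multiList α.1).map fun j => Complex.I * z j).prod • wExp w z := by
  refine BddFun.ext fun x => ?_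
  change _ = ((multiList α.1).map fun j => Complex.I * z j).prod * wExp w z x
  rw [embedFun_apply s h, wExp_apply h, multiD_eq_iterD, iterD_expFun, ← mul_assoc]
  rfl

theorem sum_ofRn_mul {n : ℕ} (t x : Rn n) :
    ∑ j, ofRn t j * (x j : ℂ) = ((inner ℝ t x : ℝ) : ℂ) := by
  simp [ofRn, PiLp.inner_apply, mul_comm]

/-- Norm continuity is where $w\to0$ enters: far out the weight is small and the exponentials differ
by at most 2, while on a ball $|e^{i(u-t,x)}-1|\le\|u-t\|\,\|x\|$. -/
theorem continuous_wExp {n : ℕ} {w : Weight n} (hw : w.VanishesAtInfinity) :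
    Continuous fun t : Rn n => wExp w (ofRn t) := by
  obtain ⟨B, hB⟩ := w.bounded'
  have hB0 : 0 ≤ B := (w.nonneg' 0).trans (hB 0)
  rw [Metric.continuous_iff]
  intro t ε hε
  obtain ⟨R, hR⟩ := (tendsto_cocompact_zero_iff _).1 hw (ε / 4) (by positivity)
  refine ⟨ε / (2 * ((|R| + 1) * (B + 1))), by positivity, fun u hu => ?_⟩
  rw [dist_eq_norm] at hu ⊢
  refine lt_of_le_of_lt (BddFun.norm_le (C := ε / 2) fun x => ?_) (half_lt_self hε)
  change ‖wExp w (ofRn u) x - wExp w (ofRn t) x‖ ≤ _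
  rw [wExp_apply (expFun_ofRn_mem_cwSub hw _), wExp_apply (expFun_ofRn_mem_cwSub hw _), ← sub_mul,
    norm_mul, Complex.norm_real]
  rcases le_or_gt R ‖x‖ with hx | hx
  · have h1 : ‖(expFun (ofRn u)).1 x - (expFun (ofRn t)).1 x‖ ≤ 2 := by
      refine (norm_sub_le _ _).trans ?_
      rw [norm_expFun_ofRn, norm_expFun_ofRn]; norm_num
    calc _ ≤ 2 * (ε / 4) := mul_le_mul h1 (hR x hx) (norm_nonneg _) (by norm_num)
      _ = ε / 2 := by ring
  · have h1 : ‖(expFun (ofRn u)).1 x - (expFun (ofRn t)).1 x‖ ≤ ‖u - t‖ * ‖x‖ := by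
      have e : (expFun (ofRn u)).1 x - (expFun (ofRn t)).1 x = (expFun (ofRn t)).1 x *
          (Complex.exp (Complex.I * ((inner ℝ (u - t) x : ℝ) : ℂ)) - 1) := by
        change Complex.exp (Complex.I * ∑ j, ofRn u j * (x j : ℂ)) -
          Complex.exp (Complex.I * ∑ j, ofRn t j * (x j : ℂ)) =
          Complex.exp (Complex.I * ∑ j, ofRn t j * (x j : ℂ)) * _
        rw [sum_ofRn_mul, sum_ofRn_mul, mul_sub, ← Complex.exp_add, inner_sub_left]
        push_cast
        ring_nf
      rw [e, norm_mul, norm_expFun_ofRn, one_mul]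
      exact Real.norm_exp_I_mul_ofReal_sub_one_le.trans (norm_inner_le_norm _ _)
    have h2 : ‖w x‖ ≤ B := by rw [Real.norm_of_nonneg (w.nonneg' x)]; exact hB x
    have h3 : ‖u - t‖ * ‖x‖ ≤ ε / (2 * ((|R| + 1) * (B + 1))) * (|R| + 1) :=
      mul_le_mul hu.le (by linarith [le_abs_self R]) (norm_nonneg _) (by positivity)
    calc _ ≤ (ε / (2 * ((|R| + 1) * (B + 1))) * (|R| + 1)) * (B + 1) :=
          mul_le_mul (h1.trans h3) (by linarith) (norm_nonneg _) (by positivity)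
      _ = ε / 2 := by field_simp

theorem continuous_embedFun_expFun {n : ℕ} {w : Weight n} (hw : w.VanishesAtInfinity)
    (s : Finset (Fin n → ℕ)) : Continuous fun t : Rn n => embedFun w s (expFun (ofRn t)) := by
  refine continuous_pi fun α => ?_
  simp_rw [embedFun_expFun s (expFun_ofRn_mem_cwSub hw _)]
  refine Continuous.smul (M := ℂ) ?_ (continuous_wExp hw)
  generalize multiList α.1 = l
  induction l with
  | nil => simpa using continuous_const
  | cons j l ih =>
    simp only [List.map_cons, List.prod_cons]
    refine Continuous.mul (continuous_const.mul ?_) ih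
    exact Complex.continuous_ofReal.comp (EuclideanSpace.proj (𝕜 := ℝ) j).continuous

/-! ### Fourier inversion in `C_w` -/

open FourierTransform in
theorem fourier_schwartzD {n : ℕ} (l : List (Fin n)) (f : 𝓢(Rn n, ℂ)) (ξ : Rn n) :
    𝓕 (schwartzD l f) ξ =
      (l.map fun j => Complex.I * ofRn ((2 * Real.pi) • ξ) j).prod * 𝓕 f ξ := by
  induction l with
  | nil => simp [schwartzD]
  | cons j l ih =>
    have hg : (fun x : Rn n => inner ℝ x (EuclideanSpace.single j (1 : ℝ))).HasTemperateGrowth := by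
      fun_prop
    rw [schwartzD_cons, SchwartzMap.fourier_lineDerivOp_eq, smul_apply,
      SchwartzMap.smulLeftCLM_apply_apply hg, ih]
    simp [ofRn, EuclideanSpace.inner_single_right]
    ring

open FourierTransform MeasureTheory in
/-- A functional that vanishes on all exponentials vanishes on the Schwartz space. -/
theorem functional_schwartz_eq_zero {n : ℕ} {w : Weight n} (hw : w.VanishesAtInfinity)
    (s : Finset (Fin n → ℕ)) (T : (s → BddFun n) →L[ℂ] ℂ)
    (hT : ∀ t : Rn n, T (embedFun w s (expFun (ofRn t))) = 0) (f : 𝓢(Rn n, ℂ)) :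
    T (embedFun w s (schwartzIncl n f)) = 0 := by
  obtain ⟨B, hB⟩ := w.bounded'
  -- The integrand of Fourier inversion, with values in the Banach space. The factor $2\pi$ matches
  -- the kernel $e^{2\pi i(\xi,x)}$ of the Fourier transform used here.
  set G : Rn n → s → BddFun n :=
    fun ξ => 𝓕 f ξ • embedFun w s (expFun (ofRn ((2 * Real.pi) • ξ))) with hG
  have hGα : ∀ α : s, (fun ξ => G ξ α) =
      fun ξ => 𝓕 (schwartzD (multiList α.1) f) ξ • wExp w (ofRn ((2 * Real.pi) • ξ)) := by
    intro α
    funext ξ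
    change 𝓕 f ξ • embedFun w s (expFun (ofRn ((2 * Real.pi) • ξ))) α = _
    rw [embedFun_expFun s (expFun_ofRn_mem_cwSub hw _), smul_smul,
      fourier_schwartzD, mul_comm]
  have hcont : Continuous fun ξ : Rn n => wExp w (ofRn ((2 * Real.pi) • ξ)) :=
    (continuous_wExp hw).comp (continuous_const_smul _)
  have hbound : ∀ ξ : Rn n, ‖wExp w (ofRn ((2 * Real.pi) • ξ))‖ ≤ B := fun ξ => by
    refine BddFun.norm_le fun x => ?_
    rw [wExp_apply (expFun_ofRn_mem_cwSub hw _), norm_mul, norm_expFun_ofRn, one_mul,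
      Complex.norm_real, Real.norm_of_nonneg (w.nonneg' x)]
    exact hB x
  have hint : ∀ α : s, Integrable (fun ξ => G ξ α) volume := fun α => by
    rw [hGα α]
    have hi : Integrable (⇑(𝓕 (schwartzD (multiList α.1) f) : 𝓢(Rn n, ℂ))) volume :=
      SchwartzMap.integrable _
    exact hi.smul_bdd B hcont.aestronglyMeasurable
      (Filter.Eventually.of_forall hbound)
  -- Point evaluations are continuous and separate bounded functions, so the vector-valued identity
  -- reduces to scalar inversion for each $\partial^\alpha f$.
  have hval : ∫ ξ, G ξ = embedFun w s (schwartzIncl n f) := by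
    refine funext fun α => BddFun.ext fun x => ?_
    rw [eval_integral hint]
    have h1 := ((lp.evalCLM ℂ (fun _ : Rn n => ℂ) ⊤ x).integral_comp_comm (hint α)).symm
    change lp.evalCLM ℂ (fun _ : Rn n => ℂ) ⊤ x (∫ ξ, G ξ α) = _
    rw [h1, embedFun_apply s (schwartzIncl_mem w f), multiD_eq_iterD, iterD_schwartzIncl]
    set h := schwartzD (multiList α.1) f
    have h2 : ∀ ξ, lp.evalCLM ℂ (fun _ : Rn n => ℂ) ⊤ x (G ξ α) =
        (Complex.exp (((2 * Real.pi * inner ℝ ξ x : ℝ) : ℂ) * Complex.I) • 𝓕 h ξ) * (w x : ℂ) := by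
      intro ξ
      rw [congrFun (hGα α) ξ, map_smul]
      change 𝓕 h ξ * wExp w (ofRn ((2 * Real.pi) • ξ)) x = _
      rw [wExp_apply (expFun_ofRn_mem_cwSub hw _)]
      change 𝓕 h ξ * (Complex.exp (Complex.I * ∑ j, ofRn ((2 * Real.pi) • ξ) j * (x j : ℂ)) * _) = _
      rw [sum_ofRn_mul, real_inner_smul_left, smul_eq_mul, mul_comm Complex.I]
      ring
    simp_rw [h2]
    rw [integral_mul_const]
    congr 1
    have h3 : 𝓕⁻ (𝓕 h) x = h x := by rw [fourierInv_fourier_eq]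
    rw [SchwartzMap.fourierInv_coe, Real.fourierInv_eq'] at h3
    exact h3
  rw [← hval, ← T.integral_comp_comm (Integrable.of_eval hint)]
  simp [hG, hT]

/-- Exponentials with frequencies in a dense subset of `ℝⁿ`. -/
theorem functional_eq_zero_of_dense {n : ℕ} {w : Weight n} (hw : w.VanishesAtInfinity)
    (s : Finset (Fin n → ℕ)) (T : (s → BddFun n) →L[ℂ] ℂ) {E : Set (Rn n)}
    (hT : ∀ t ∈ E, T (embedFun w s (expFun (ofRn t))) = 0) (t : Rn n) (ht : t ∈ closure E) :
    T (embedFun w s (expFun (ofRn t))) = 0 := by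
  have hc : IsClosed {t : Rn n | T (embedFun w s (expFun (ofRn t))) = 0} :=
    isClosed_eq (T.continuous.comp (continuous_embedFun_expFun hw s)) continuous_const
  exact hc.closure_subset_iff.2 hT ht


/-! ### Holomorphic weights -/

theorem norm_ofRn {n : ℕ} (x : Rn n) : ‖ofRn x‖ = ‖x‖ := by
  simp [ofRn, EuclideanSpace.norm_eq]

theorem norm_sum_mul_le {n : ℕ} (h : Cn n) (x : Rn n) :
    ‖∑ j, h j * (x j : ℂ)‖ ≤ ‖h‖ * ‖x‖ := by
  have e : ∑ j, h j * (x j : ℂ) = inner ℂ (ofRn x) h := by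
    simp [ofRn, PiLp.inner_apply]
  rw [e, mul_comm, ← norm_ofRn x]
  exact norm_inner_le_norm _ _

theorem norm_expFun_le {n : ℕ} (z : Cn n) (x : Rn n) : ‖(expFun z).1 x‖ ≤
    Real.exp (‖(WithLp.toLp 2 (fun j => (z j).im) : Rn n)‖ * ‖x‖) := by
  rw [norm_expFun_apply]
  refine Real.exp_le_exp.2 ((neg_le_abs _).trans ?_)
  have e : ∑ j, (z j).im * x j = inner ℝ (WithLp.toLp 2 (fun j => (z j).im) : Rn n) x := by
    simp [PiLp.inner_apply, mul_comm]
  rw [e]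
  exact abs_real_inner_le_norm _ _

/-- Below the supremum `w.tau` there is an admissible rate `ε` exceeding the growth rate
$\|\operatorname{Im}z\|$ of the exponential; the difference is the `δ`. -/
theorem exists_decay_of_mem_tube {n : ℕ} {w : Weight n} {z : Cn n} (hz : z ∈ w.tube) :
    ∃ δ > 0, ∃ C, 0 ≤ C ∧ ∀ x, ‖(expFun z).1 x‖ * w x ≤ C * Real.exp (-δ * ‖x‖) := by
  have hz' : ENNReal.ofReal ‖(WithLp.toLp 2 (fun j => (z j).im) : Rn n)‖ < w.tau := hz
  rw [Weight.tau, lt_iSup_iff] at hz'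
  obtain ⟨ε, hε⟩ := hz'
  rw [lt_iSup_iff] at hε
  obtain ⟨⟨hε0, C, hC0, hC⟩, hlt⟩ := hε
  rw [ENNReal.ofReal_lt_ofReal_iff hε0] at hlt
  refine ⟨ε - ‖(WithLp.toLp 2 (fun j => (z j).im) : Rn n)‖, sub_pos.2 hlt, C, hC0, fun x => ?_⟩
  calc _ ≤ Real.exp (‖(WithLp.toLp 2 (fun j => (z j).im) : Rn n)‖ * ‖x‖) *
        (C * Real.exp (-ε * ‖x‖)) :=
        mul_le_mul (norm_expFun_le z x) (hC x) (w.nonneg' x) (Real.exp_pos _).le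
    _ = _ := by
      rw [mul_left_comm, ← Real.exp_add]
      ring_nf

theorem pow_mul_exp_neg_le {δ : ℝ} (hδ : 0 < δ) (k : ℕ) {r : ℝ} (hr : 0 ≤ r) :
    r ^ k * Real.exp (-δ * r) ≤ k.factorial / δ ^ k := by
  have h := Real.pow_div_factorial_le_exp (δ * r) (by positivity) k
  rw [div_le_iff₀ (by positivity), mul_pow] at h
  rw [neg_mul, Real.exp_neg, ← div_eq_mul_inv, div_le_div_iff₀ (Real.exp_pos _) (by positivity)]
  linarith

theorem tendsto_exp_neg_mul_norm {n : ℕ} {δ : ℝ} (hδ : 0 < δ) (C : ℝ) :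
    Filter.Tendsto (fun x : Rn n => C * Real.exp (-δ * ‖x‖)) (Filter.cocompact (Rn n)) (𝓝 0) := by
  have h1 : Filter.Tendsto (fun x : Rn n => δ * ‖x‖) (Filter.cocompact (Rn n)) Filter.atTop :=
    (tendsto_norm_cocompact_atTop (E := Rn n)).const_mul_atTop hδ
  have h2 := (Real.tendsto_exp_neg_atTop_nhds_zero.comp h1).const_mul C
  rw [mul_zero] at h2
  refine h2.congr fun x => ?_
  simp

theorem expFun_mem_of_decay {n : ℕ} {w : Weight n} {z : Cn n} {δ C : ℝ} (hδ : 0 < δ)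
    (h : ∀ x, ‖(expFun z).1 x‖ * w x ≤ C * Real.exp (-δ * ‖x‖)) : expFun z ∈ cwSub w := by
  refine expFun_mem_cwSub (squeeze_zero_norm (fun x => ?_) (tendsto_exp_neg_mul_norm hδ C))
  rw [norm_mul, Complex.norm_real, Real.norm_of_nonneg (w.nonneg' x)]
  exact h x

theorem expFun_mem_of_mem_tube {n : ℕ} {w : Weight n} {z : Cn n} (hz : z ∈ w.tube) :
    expFun z ∈ cwSub w := by
  obtain ⟨δ, hδ, C, -, h⟩ := exists_decay_of_mem_tube hz
  exact expFun_mem_of_decay hδ h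

theorem ofRn_mem_tube {n : ℕ} {w : Weight n} (hw : w.IsHolomorphic) (t : Rn n) :
    ofRn t ∈ w.tube := by
  obtain ⟨ε, hε, h⟩ := hw
  have e : (WithLp.toLp 2 (fun j => (ofRn t j).im) : Rn n) = 0 := by
    ext j; simp [ofRn]
  change ENNReal.ofReal ‖(WithLp.toLp 2 (fun j => (ofRn t j).im) : Rn n)‖ < w.tau
  rw [e, norm_zero, ENNReal.ofReal_zero]
  exact (ENNReal.ofReal_pos.2 hε).trans_le
    (le_iSup₂_of_le (f := fun (ε : ℝ) (_ : 0 < ε ∧ w.HasExpDecay ε) => ENNReal.ofReal ε)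
      ε ⟨hε, h⟩ le_rfl)

/-- The candidate derivative is $h\mapsto i(h,x)e_{iz}w$. The second-order Taylor remainder of the
exponential is uniformly $O(\|h\|^2)$, since the exponential decay of $e_{iz}w$ dominates
$\|x\|^2e^{\|h\|\|x\|}$ for small `h`. -/
theorem differentiableAt_wExp {n : ℕ} {w : Weight n} {z : Cn n} (hz : z ∈ w.tube) :
    DifferentiableAt ℂ (wExp w) z := by
  obtain ⟨δ, hδ, C, hC0, hC⟩ := exists_decay_of_mem_tube hz
  have hadd : ∀ (h : Cn n) (x : Rn n), (expFun (z + h)).1 x =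
      (expFun z).1 x * Complex.exp (Complex.I * ∑ j, h j * (x j : ℂ)) := by
    intro h x
    change Complex.exp (Complex.I * ∑ j, (z j + h j) * (x j : ℂ)) =
      Complex.exp (Complex.I * ∑ j, z j * (x j : ℂ)) * _
    rw [← Complex.exp_add, ← mul_add, ← Finset.sum_add_distrib]
    simp_rw [add_mul]
  have hIle : ∀ (h : Cn n) (x : Rn n), ‖Complex.I * ∑ j, h j * (x j : ℂ)‖ ≤ ‖h‖ * ‖x‖ := by
    intro h x
    rw [norm_mul, Complex.norm_I, one_mul]
    exact norm_sum_mul_le h x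
  have hD : ∀ (h : Cn n) (x : Rn n),
      ‖(Complex.I * ∑ j, h j * (x j : ℂ)) * ((expFun z).1 x * (w x : ℂ))‖ ≤ ‖h‖ * (C / δ) := by
    intro h x
    rw [norm_mul, norm_mul (_ : ℂ) (w x : ℂ), Complex.norm_real, Real.norm_of_nonneg (w.nonneg' x)]
    calc _ ≤ (‖h‖ * ‖x‖) * (C * Real.exp (-δ * ‖x‖)) :=
          mul_le_mul (hIle h x) (hC x) (mul_nonneg (norm_nonneg _) (w.nonneg' x)) (by positivity)
      _ = ‖h‖ * (C * (‖x‖ ^ 1 * Real.exp (-δ * ‖x‖))) := by ring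
      _ ≤ ‖h‖ * (C * ((Nat.factorial 1 : ℕ) / δ ^ 1)) := by
          gcongr
          exact pow_mul_exp_neg_le hδ 1 (norm_nonneg x)
      _ = ‖h‖ * (C / δ) := by simp [div_eq_mul_inv]
  let D : Cn n →ₗ[ℂ] BddFun n :=
    { toFun := fun h => toBdd fun x => (Complex.I * ∑ j, h j * (x j : ℂ)) *
        ((expFun z).1 x * (w x : ℂ))
      map_add' := fun h k => by
        refine BddFun.ext fun x => ?_
        refine (toBdd_apply_of_le (hD (h + k)) x).trans ?_
        refine Eq.trans ?_ (congrArg₂ (· + ·) (toBdd_apply_of_le (hD h) x)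
          (toBdd_apply_of_le (hD k) x)).symm
        simp only [PiLp.add_apply, add_mul, Finset.sum_add_distrib, mul_add]
      map_smul' := fun c h => by
        refine BddFun.ext fun x => ?_
        refine (toBdd_apply_of_le (hD (c • h)) x).trans ?_
        refine Eq.trans ?_ (congrArg (c * ·) (toBdd_apply_of_le (hD h) x)).symm
        simp only [PiLp.smul_apply, smul_eq_mul, mul_assoc, ← Finset.mul_sum]
        ring }
  have hDx : ∀ h x, D h x = (Complex.I * ∑ j, h j * (x j : ℂ)) * ((expFun z).1 x * (w x : ℂ)) :=
    fun h x => toBdd_apply_of_le (hD h) x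
  refine HasFDerivAt.differentiableAt (f' := LinearMap.toContinuousLinearMap D) ?_
  rw [hasFDerivAt_iff_isLittleO_nhds_zero, Asymptotics.isLittleO_iff]
  intro c hc
  -- Half of the decay rate absorbs $e^{\|h\|\|x\|}$ when `‖h‖ ≤ δ / 2`; the other half bounds
  -- $\|x\|^2$, whence $2!/(\delta/2)^2$.
  set K := C * ((Nat.factorial 2 : ℕ) / (δ / 2) ^ 2) with hK
  have hK0 : 0 ≤ K := by positivity
  have hev : ∀ᶠ h : Cn n in 𝓝 0, ‖h‖ < min (δ / 2) (c / (K + 1)) := by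
    have : Filter.Tendsto (fun h : Cn n => ‖h‖) (𝓝 0) (𝓝 0) := tendsto_norm_zero
    exact this.eventually (gt_mem_nhds (by positivity))
  filter_upwards [hev] with h hh
  have hh1 : ‖h‖ ≤ δ / 2 := (hh.trans_le (min_le_left _ _)).le
  have hh2 : ‖h‖ ≤ c / (K + 1) := (hh.trans_le (min_le_right _ _)).le
  have hexp : ∀ x : Rn n, Real.exp (-δ * ‖x‖) * Real.exp (‖h‖ * ‖x‖) ≤
      Real.exp (-(δ / 2) * ‖x‖) := by
    intro x
    rw [← Real.exp_add, Real.exp_le_exp]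
    nlinarith [mul_le_mul_of_nonneg_right hh1 (norm_nonneg x)]
  have hmem : expFun (z + h) ∈ cwSub w := by
    refine expFun_mem_of_decay (half_pos hδ) (C := C) fun x => ?_
    have h1 : ‖Complex.exp (Complex.I * ∑ j, h j * (x j : ℂ))‖ ≤ Real.exp (‖h‖ * ‖x‖) :=
      (Complex.norm_exp_le_exp_norm _).trans (Real.exp_le_exp.2 (hIle h x))
    rw [hadd, norm_mul, mul_right_comm]
    calc _ ≤ (C * Real.exp (-δ * ‖x‖)) * Real.exp (‖h‖ * ‖x‖) :=
          mul_le_mul (hC x) h1 (norm_nonneg _) (by positivity)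
      _ ≤ C * Real.exp (-(δ / 2) * ‖x‖) := by
          rw [mul_assoc]
          exact mul_le_mul_of_nonneg_left (hexp x) hC0
  have hmain : ‖wExp w (z + h) - wExp w z - D h‖ ≤ K * ‖h‖ ^ 2 := by
    refine BddFun.norm_le fun x => ?_
    change ‖wExp w (z + h) x - wExp w z x - D h x‖ ≤ _
    rw [wExp_apply hmem, wExp_apply (expFun_mem_of_mem_tube hz), hDx, hadd]
    set a := Complex.I * ∑ j, h j * (x j : ℂ) with ha
    have e : (expFun z).1 x * Complex.exp a * (w x : ℂ) - (expFun z).1 x * (w x : ℂ) -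
        a * ((expFun z).1 x * (w x : ℂ)) =
        ((expFun z).1 x * (w x : ℂ)) * (Complex.exp a - 1 - a) := by ring
    have h1 : ‖Complex.exp a - 1 - a‖ ≤ (‖h‖ * ‖x‖) ^ 2 * Real.exp (‖h‖ * ‖x‖) := by
      have := Complex.norm_exp_sub_sum_le_norm_mul_exp a 2
      simp only [Finset.sum_range_succ, Finset.sum_range_zero] at this
      norm_num at this
      rw [← sub_sub] at this
      refine this.trans ?_
      have := hIle h x
      gcongr
    rw [e, norm_mul, norm_mul, Complex.norm_real, Real.norm_of_nonneg (w.nonneg' x)]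
    calc _ ≤ (C * Real.exp (-δ * ‖x‖)) * ((‖h‖ * ‖x‖) ^ 2 * Real.exp (‖h‖ * ‖x‖)) :=
          mul_le_mul (hC x) h1 (norm_nonneg _) (by positivity)
      _ = C * (‖x‖ ^ 2 * (Real.exp (-δ * ‖x‖) * Real.exp (‖h‖ * ‖x‖))) * ‖h‖ ^ 2 := by ring
      _ ≤ C * (‖x‖ ^ 2 * Real.exp (-(δ / 2) * ‖x‖)) * ‖h‖ ^ 2 := by
          have := hexp x
          gcongr
      _ ≤ K * ‖h‖ ^ 2 := by
          have := pow_mul_exp_neg_le (half_pos hδ) 2 (norm_nonneg x)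
          rw [hK]
          gcongr
  refine hmain.trans ?_
  calc K * ‖h‖ ^ 2 = (K * ‖h‖) * ‖h‖ := by ring
    _ ≤ c * ‖h‖ := by
      refine mul_le_mul_of_nonneg_right ?_ (norm_nonneg _)
      calc K * ‖h‖ ≤ K * (c / (K + 1)) := by gcongr
        _ ≤ c := by
          rw [mul_div_assoc', div_le_iff₀ (by positivity)]
          nlinarith

/-- Exponentials with frequencies in a uniqueness set of the tube domain. -/
theorem functional_eq_zero_of_isUniquenessSet {n : ℕ} {w : Weight n}
    (s : Finset (Fin n → ℕ)) (T : (s → BddFun n) →L[ℂ] ℂ) {E : Set (Cn n)}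
    (hE : IsUniquenessSet E w.tube) (hT : ∀ z ∈ E, T (embedFun w s (expFun z)) = 0)
    (z : Cn n) (hz : z ∈ w.tube) : T (embedFun w s (expFun z)) = 0 := by
  refine hE.2 (fun z => T (embedFun w s (expFun z))) ?_ hT z hz
  refine T.differentiable.comp_differentiableOn (differentiableOn_pi.2 fun α => ?_)
  have h : DifferentiableOn ℂ (fun z : Cn n =>
      ((multiList α.1).map fun j => Complex.I * z j).prod • wExp w z) w.tube := by
    refine DifferentiableOn.smul (𝕜' := ℂ) ?_ fun z hz => (differentiableAt_wExp hz).differentiableWithinAt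
    refine Differentiable.differentiableOn ?_
    generalize multiList α.1 = l
    induction l with
    | nil => simp
    | cons j l ih =>
      simp only [List.map_cons, List.prod_cons]
      refine Differentiable.mul (Differentiable.const_mul ?_ _) ih
      exact (EuclideanSpace.proj (𝕜 := ℂ) j).differentiable
  exact h.congr fun z hz => embedFun_expFun s (expFun_mem_of_mem_tube hz) α

theorem Weight.IsHolomorphic.vanishesAtInfinity {n : ℕ} {w : Weight n} (hw : w.IsHolomorphic) :
    w.VanishesAtInfinity := by
  obtain ⟨ε, hε, C, -, h⟩ := hw
  exact squeeze_zero w.nonneg' h (tendsto_exp_neg_mul_norm hε C)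

/-- Holomorphic weights are quasi-analytic. -/
theorem Weight.IsHolomorphic.isQuasiAnalytic {n : ℕ} {w : Weight n} (hw : w.IsHolomorphic) :
    w.IsQuasiAnalytic := by
  obtain ⟨ε, hε, C, hC0, h⟩ := hw
  refine ⟨(EuclideanSpace.basisFun (Fin n) ℝ).toBasis, fun j => ?_⟩
  set v : Rn n := (EuclideanSpace.basisFun (Fin n) ℝ).toBasis j with hv
  have hvn : ‖v‖ = 1 := by simp [hv]
  set B := max C 1 with hB
  have hB1 : 1 ≤ B := le_max_right _ _
  -- From $r^ke^{-\epsilon r}\le k!/\epsilon^k\le(k/\epsilon)^k$. The series of roots is therefore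
  -- bounded below by a multiple of the harmonic series.
  have hM : ∀ m : ℕ, w.M v (m + 1) ≤ ENNReal.ofReal ((B * ((m + 1) / ε)) ^ (m + 1)) := by
    intro m
    refine iSup_le fun x => ENNReal.ofReal_le_ofReal ?_
    have h1 : |inner ℝ v x| ≤ ‖x‖ := by
      simpa [hvn] using abs_real_inner_le_norm v x
    have h2 := pow_mul_exp_neg_le hε (m + 1) (norm_nonneg x)
    have h3 : ((m + 1).factorial : ℝ) ≤ ((m : ℝ) + 1) ^ (m + 1) := by
      exact_mod_cast Nat.factorial_le_pow (m + 1)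
    calc |inner ℝ v x| ^ (m + 1) * w x
        ≤ ‖x‖ ^ (m + 1) * (C * Real.exp (-ε * ‖x‖)) :=
          mul_le_mul (pow_le_pow_left₀ (abs_nonneg _) h1 _) (h x) (w.nonneg' x) (by positivity)
      _ = C * (‖x‖ ^ (m + 1) * Real.exp (-ε * ‖x‖)) := by ring
      _ ≤ B * (((m : ℝ) + 1) ^ (m + 1) / ε ^ (m + 1)) := by
          refine mul_le_mul (le_max_left _ _) (h2.trans ?_) (by positivity) (by positivity)
          gcongr
      _ ≤ B ^ (m + 1) * (((m : ℝ) + 1) ^ (m + 1) / ε ^ (m + 1)) := by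
          gcongr
          exact le_self_pow₀ hB1 (Nat.succ_ne_zero m)
      _ = (B * ((m + 1) / ε)) ^ (m + 1) := by rw [mul_pow, div_pow]
  have hterm : ∀ m : ℕ, ENNReal.ofReal (ε / B * (1 / ((m : ℝ) + 1))) ≤
      w.M v (m + 1) ^ (-(1 / ((m : ℝ) + 1))) := by
    intro m
    have hpos : 0 < B * (((m : ℝ) + 1) / ε) := by positivity
    rw [ENNReal.rpow_neg, ENNReal.le_inv_iff_le_inv, ← ENNReal.ofReal_inv_of_pos (by positivity)]
    refine (ENNReal.rpow_le_rpow (hM m) (by positivity)).trans ?_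
    rw [ENNReal.ofReal_rpow_of_pos (by positivity)]
    refine ENNReal.ofReal_le_ofReal (le_of_eq ?_)
    rw [← Real.rpow_natCast, ← Real.rpow_mul hpos.le]
    push_cast
    rw [mul_one_div_cancel (by positivity), Real.rpow_one]
    field_simp
  by_contra hne
  have hne' : ∑' m : ℕ, ENNReal.ofReal (ε / B * (1 / ((m : ℝ) + 1))) ≠ ⊤ :=
    ne_top_of_le_ne_top hne (ENNReal.tsum_le_tsum hterm)
  have hs : Summable fun m : ℕ => ε / B * (1 / ((m : ℝ) + 1)) := by
    have := ENNReal.summable_toReal hne'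
    refine this.congr fun m => ENNReal.toReal_ofReal (by positivity)
  have hs2 : Summable fun m : ℕ => 1 / ((m : ℝ) + 1) :=
    (summable_mul_left_iff (show ε / B ≠ 0 by positivity)).1 hs
  refine Real.not_summable_one_div_natCast ((summable_nat_add_iff 1).1 ?_)
  simpa using hs2


/-! ### Quasi-analytic weights: moments -/

theorem Weight.le_M {n : ℕ} (w : Weight n) (v : Rn n) (m : ℕ) (x : Rn n) :
    ENNReal.ofReal (|inner ℝ v x| ^ m * w x) ≤ w.M v m :=
  le_iSup (fun x => ENNReal.ofReal (|inner ℝ v x| ^ m * w x)) x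

theorem Weight.M_eq_top_mono {n : ℕ} (w : Weight n) (v : Rn n) {m k : ℕ} (hmk : m ≤ k)
    (hm : w.M v m = ⊤) : w.M v k = ⊤ := by
  obtain ⟨B, hB⟩ := w.bounded'
  by_contra hk
  have hle : w.M v m ≤ w.M v k + ENNReal.ofReal B := by
    refine iSup_le fun x => ?_
    have h1 : |inner ℝ v x| ^ m * w x ≤ |inner ℝ v x| ^ k * w x + B := by
      have hx := w.nonneg' x
      rcases le_total 1 |inner ℝ v x| with h | h
      · have h2 := mul_le_mul_of_nonneg_right (pow_le_pow_right₀ h hmk) hx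
        linarith [hx.trans (hB x)]
      · have h2 := mul_le_of_le_one_left hx (pow_le_one₀ (n := m) (abs_nonneg _) h)
        have h3 : 0 ≤ |inner ℝ v x| ^ k * w x := by positivity
        linarith [hB x]
    refine (ENNReal.ofReal_le_ofReal h1).trans (ENNReal.ofReal_add_le.trans ?_)
    gcongr
    exact w.le_M v k x
  rw [hm, top_le_iff] at hle
  exact ENNReal.add_ne_top.2 ⟨hk, ENNReal.ofReal_ne_top⟩ hle

/-- A vanishing moment forces $(v,x)\,w(x)=0$ for all `x`. The order `k = 0` is excluded because
$0^0=1$. -/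
theorem Weight.M_eq_zero {n : ℕ} (w : Weight n) (v : Rn n) {m k : ℕ} (hk : k ≠ 0)
    (hm : w.M v m = 0) : w.M v k = 0 := by
  refine le_antisymm (iSup_le fun x => ?_) (zero_le)
  have h1 := (w.le_M v m x).trans hm.le
  have h2 : |inner ℝ v x| ^ m * w x = 0 :=
    le_antisymm (ENNReal.ofReal_eq_zero.1 (le_antisymm h1 (zero_le)))
      (mul_nonneg (by positivity) (w.nonneg' x))
  have h3 : |inner ℝ v x| ^ k * w x = 0 := by
    rcases mul_eq_zero.1 h2 with h | h
    · rw [eq_zero_of_pow_eq_zero h, zero_pow hk, zero_mul]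
    · rw [h, mul_zero]
  rw [h3]
  simp

/-- The moments of a quasi-analytic weight are finite. -/
theorem Weight.M_ne_top {n : ℕ} (w : Weight n) (v : Rn n)
    (h : ∑' m : ℕ, w.M v (m + 1) ^ (-(1 / ((m : ℝ) + 1))) = ⊤) (m : ℕ) : w.M v m ≠ ⊤ := by
  intro hm
  -- If one moment is infinite, so are all later ones, and the series reduces to a finite sum. That
  -- sum is infinite only if an earlier moment vanishes, which would make the infinite one zero.
  have hzero : ∀ k, k ∉ Finset.range m → w.M v (k + 1) ^ (-(1 / ((k : ℝ) + 1))) = 0 := by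
    intro k hk
    rw [w.M_eq_top_mono v (by simp at hk; omega) hm, ENNReal.top_rpow_of_neg]
    have : (0 : ℝ) < 1 / ((k : ℝ) + 1) := by positivity
    linarith
  rw [tsum_eq_sum hzero, ENNReal.sum_eq_top] at h
  obtain ⟨k, hk, hkt⟩ := h
  have hpos : (0 : ℝ) < 1 / ((k : ℝ) + 1) := by positivity
  have h0 : w.M v (k + 1) = 0 := by
    rcases ENNReal.rpow_eq_top_iff.1 hkt with h | h
    · exact h.1
    · exact absurd h.2 (by linarith)
  have hm0 : m ≠ 0 := by
    rintro rfl
    simp at hk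
  rw [w.M_eq_zero v hm0 h0] at hm
  exact ENNReal.zero_ne_top hm

/-- The truncated moments `max 1 (sup_x |(v, x)|^m w(x))`. -/
def Weight.mom {n : ℕ} (w : Weight n) (v : Rn n) (m : ℕ) : ℝ := max 1 (w.M v m).toReal

theorem Weight.one_le_mom {n : ℕ} (w : Weight n) (v : Rn n) (m : ℕ) : 1 ≤ w.mom v m :=
  le_max_left _ _

theorem Weight.mom_pos {n : ℕ} (w : Weight n) (v : Rn n) (m : ℕ) : 0 < w.mom v m :=
  one_pos.trans_le (w.one_le_mom v m)

theorem Weight.le_mom {n : ℕ} {w : Weight n} {v : Rn n} (hfin : ∀ m, w.M v m ≠ ⊤) (m : ℕ)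
    (x : Rn n) : |inner ℝ v x| ^ m * w x ≤ w.mom v m :=
  ((ENNReal.ofReal_le_iff_le_toReal (hfin m)).1 (w.le_M v m x)).trans (le_max_right _ _)

/-- Log-convexity holds pointwise in `x`, hence for the suprema, and it survives truncation at 1. -/
theorem Weight.mom_logConvex {n : ℕ} {w : Weight n} {v : Rn n} (hfin : ∀ m, w.M v m ≠ ⊤) (m : ℕ) :
    w.mom v (m + 1) ^ 2 ≤ w.mom v m * w.mom v (m + 2) := by
  have h0 : 0 ≤ w.mom v m * w.mom v (m + 2) := (mul_pos (w.mom_pos v _) (w.mom_pos v _)).le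
  rw [← Real.le_sqrt (w.mom_pos v _).le h0]
  refine max_le ?_ ?_
  · rw [Real.one_le_sqrt]
    exact one_le_mul_of_one_le_of_one_le (w.one_le_mom v _) (w.one_le_mom v _)
  · refine ENNReal.toReal_le_of_le_ofReal (Real.sqrt_nonneg _) (iSup_le fun x => ?_)
    refine ENNReal.ofReal_le_ofReal (Real.le_sqrt_of_sq_le ?_)
    calc (|inner ℝ v x| ^ (m + 1) * w x) ^ 2
        = (|inner ℝ v x| ^ m * w x) * (|inner ℝ v x| ^ (m + 2) * w x) := by ring
      _ ≤ _ := mul_le_mul (w.le_mom hfin m x) (w.le_mom hfin (m + 2) x)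
          (mul_nonneg (by positivity) (w.nonneg' x)) (w.mom_pos v _).le

/-- The truncation is harmless: if the truncated series converged, its terms would tend to 0, so the
truncation would eventually be inactive and no moment of positive order could vanish. -/
theorem Weight.mom_not_summable {n : ℕ} {w : Weight n} {v : Rn n}
    (h : ∑' m : ℕ, w.M v (m + 1) ^ (-(1 / ((m : ℝ) + 1))) = ⊤) :
    ¬ Summable fun m : ℕ => w.mom v (m + 1) ^ (-(((m : ℝ) + 1)⁻¹)) := by
  have hfin := w.M_ne_top v h
  intro hs
  have hlt : ∀ᶠ m : ℕ in Filter.atTop, w.mom v (m + 1) ^ (-(((m : ℝ) + 1)⁻¹)) < 1 :=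
    hs.tendsto_atTop_zero.eventually (gt_mem_nhds one_pos)
  obtain ⟨k, hk⟩ := Filter.eventually_atTop.1 hlt
  have heq : ∀ m ≥ k, w.mom v (m + 1) = (w.M v (m + 1)).toReal := by
    intro m hm
    refine max_eq_right (le_of_not_gt fun hlt1 => ?_)
    have := hk m hm
    rw [Weight.mom, max_eq_left hlt1.le, Real.one_rpow] at this
    exact this.false
  have hne : ∀ m, w.M v (m + 1) ≠ 0 := by
    intro m hm
    have h1 := heq k le_rfl
    rw [w.M_eq_zero v (Nat.succ_ne_zero k) hm] at h1
    have h2 := w.one_le_mom v (k + 1)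
    rw [h1] at h2
    norm_num at h2
  have hterm : ∀ m, w.M v (m + 1) ^ (-(1 / ((m : ℝ) + 1))) ≠ ⊤ := by
    intro m htop
    rcases ENNReal.rpow_eq_top_iff.1 htop with h | h
    · exact hne m h.1
    · exact hfin _ h.1
  have hs2 : Summable fun m : ℕ => (w.M v (m + 1) ^ (-(1 / ((m : ℝ) + 1)))).toReal := by
    rw [← summable_nat_add_iff k] at hs ⊢
    refine hs.congr fun m => ?_
    rw [heq _ (by omega), ← ENNReal.toReal_rpow, one_div]
  refine hs2.tsum_ofReal_ne_top ?_
  simp_rw [ENNReal.ofReal_toReal (hterm _)]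
  exact h

/-- `w` decreases more rapidly than the reciprocal of any polynomial. -/
def Weight.RapidDecay {n : ℕ} (w : Weight n) : Prop :=
  ∀ p : MvPolynomial (Fin n) ℂ, ∃ C : ℝ, ∀ x, ‖(polyMap n p).1 x‖ * w x ≤ C

theorem exists_norm_polyMap_le {n : ℕ} (p : MvPolynomial (Fin n) ℂ) :
    ∃ (C : ℝ) (d : ℕ), 0 ≤ C ∧ ∀ x, ‖(polyMap n p).1 x‖ ≤ C * (1 + ‖x‖) ^ d := by
  induction p using MvPolynomial.induction_on with
  | C a => exact ⟨‖a‖, 0, norm_nonneg _, fun x => by simp [polyMap_apply]⟩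
  | add p q hp hq =>
    obtain ⟨C, d, hC, h⟩ := hp
    obtain ⟨C', d', hC', h'⟩ := hq
    refine ⟨C + C', max d d', by positivity, fun x => ?_⟩
    have h1 : (1 : ℝ) ≤ 1 + ‖x‖ := by linarith [norm_nonneg x]
    rw [map_add]
    refine (norm_add_le _ _).trans ((add_le_add (h x) (h' x)).trans ?_)
    rw [add_mul]
    gcongr
    · exact le_max_left _ _
    · exact le_max_right _ _
  | mul_X p j hp =>
    obtain ⟨C, d, hC, h⟩ := hp
    refine ⟨C, d + 1, hC, fun x => ?_⟩
    have h1 : ‖(x j : ℂ)‖ ≤ 1 + ‖x‖ := by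
      rw [Complex.norm_real]
      linarith [PiLp.norm_apply_le x j]
    have h2 := h x
    rw [polyMap_apply] at h2 ⊢
    rw [map_mul, MvPolynomial.eval_X, norm_mul, pow_succ, ← mul_assoc]
    gcongr

theorem Weight.IsQuasiAnalyticWrt.norm_pow_le {n : ℕ} {w : Weight n}
    {v : Module.Basis (Fin n) ℝ (Rn n)} (hv : w.IsQuasiAnalyticWrt v) (m : ℕ) :
    ∃ C : ℝ, ∀ x, ‖x‖ ^ m * w x ≤ C := by
  obtain ⟨B, hB⟩ := w.bounded'
  have hB0 : 0 ≤ B := (w.nonneg' 0).trans (hB 0)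
  rcases isEmpty_or_nonempty (Fin n) with hn | hn
  · refine ⟨B, fun x => (mul_le_of_le_one_left (w.nonneg' x) (pow_le_one₀ (norm_nonneg _) ?_)).trans
      (hB x)⟩
    rw [Subsingleton.elim x 0, norm_zero]
    exact zero_le_one
  -- The pairings with a basis determine `x`, and an injective linear map in finite dimension is
  -- bounded below; so $\|x\|$ is controlled by the largest $|(v_j,x)|$.
  let A : Rn n →ₗ[ℝ] (Fin n → ℝ) := LinearMap.pi fun j => (innerSL ℝ (v j) : Rn n →ₗ[ℝ] ℝ)
  have hA : LinearMap.ker A = ⊥ := by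
    rw [LinearMap.ker_eq_bot']
    intro x hx
    have h0 : (innerSL ℝ x : Rn n →ₗ[ℝ] ℝ) = 0 := v.ext fun j =>
      (real_inner_comm x (v j)).symm.trans (congrFun hx j)
    exact inner_self_eq_zero.1 (LinearMap.congr_fun h0 x)
  obtain ⟨K, -, hK⟩ := A.exists_antilipschitzWith hA
  refine ⟨(K : ℝ) ^ m * ∑ j, w.mom (v j) m, fun x => ?_⟩
  have h1 : ‖x‖ ≤ K * ‖A x‖ := by
    have := hK.le_mul_dist x 0
    simpa using this
  obtain ⟨i, hi⟩ := Finite.exists_max fun j => |inner ℝ (v j) x|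
  have h2 : ‖A x‖ ≤ |inner ℝ (v i) x| :=
    (pi_norm_le_iff_of_nonneg (abs_nonneg _)).2 fun j => hi j
  calc ‖x‖ ^ m * w x ≤ (K * |inner ℝ (v i) x|) ^ m * w x := by
        have := w.nonneg' x
        gcongr
        exact h1.trans (by gcongr)
    _ = (K : ℝ) ^ m * (|inner ℝ (v i) x| ^ m * w x) := by rw [mul_pow, mul_assoc]
    _ ≤ (K : ℝ) ^ m * w.mom (v i) m := by
        gcongr
        exact Weight.le_mom (w.M_ne_top _ (hv i)) m x
    _ ≤ _ := by
        gcongr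
        exact Finset.single_le_sum (f := fun j => w.mom (v j) m)
          (fun j _ => (w.mom_pos (v j) m).le) (Finset.mem_univ i)

theorem Weight.IsQuasiAnalyticWrt.rapidDecay {n : ℕ} {w : Weight n}
    {v : Module.Basis (Fin n) ℝ (Rn n)} (hv : w.IsQuasiAnalyticWrt v) : w.RapidDecay := by
  intro p
  obtain ⟨B, hB⟩ := w.bounded'
  obtain ⟨C, d, hC, h⟩ := exists_norm_polyMap_le p
  obtain ⟨D, hD⟩ := hv.norm_pow_le d
  refine ⟨C * (2 ^ d * (B + D)), fun x => ?_⟩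
  have hw := w.nonneg' x
  have h1 : (1 + ‖x‖) ^ d ≤ 2 ^ d * (1 + ‖x‖ ^ d) := by
    have h2 : 1 + ‖x‖ ≤ 2 * max 1 ‖x‖ := by
      linarith [le_max_left 1 ‖x‖, le_max_right 1 ‖x‖]
    have h3 : (max 1 ‖x‖) ^ d ≤ 1 + ‖x‖ ^ d := by
      rcases max_cases 1 ‖x‖ with h | h
      · rw [h.1, one_pow]; linarith [pow_nonneg (norm_nonneg x) d]
      · rw [h.1]; linarith
    calc (1 + ‖x‖) ^ d ≤ (2 * max 1 ‖x‖) ^ d := by gcongr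
      _ = 2 ^ d * (max 1 ‖x‖) ^ d := mul_pow _ _ _
      _ ≤ _ := by gcongr
  calc _ ≤ C * (2 ^ d * (1 + ‖x‖ ^ d)) * w x := by
        gcongr
        exact (h x).trans (by gcongr)
    _ = C * (2 ^ d * (w x + ‖x‖ ^ d * w x)) := by ring
    _ ≤ _ := by
        gcongr
        · exact hB x
        · exact hD x

/-- Data expressing that `w` is quasi-analytic in the direction `v`, stable under multiplication of
the weight by polynomials. -/
structure IsQASeq {n : ℕ} (w : Weight n) (v : Rn n) (N : ℕ → ℝ) : Prop where
  one_le : ∀ m, 1 ≤ N m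
  logConvex : ∀ m, N (m + 1) ^ 2 ≤ N m * N (m + 2)
  not_summable : ¬ Summable fun m => N m / N (m + 1)
  bound : ∀ p : MvPolynomial (Fin n) ℂ, ∃ C : ℝ, ∀ m x,
    |inner ℝ v x| ^ m * (‖(polyMap n p).1 x‖ * w x) ≤ C * N m

theorem IsQASeq.neg {n : ℕ} {w : Weight n} {v : Rn n} {N : ℕ → ℝ} (h : IsQASeq w v N) :
    IsQASeq w (-v) N where
  one_le := h.one_le
  logConvex := h.logConvex
  not_summable := h.not_summable
  bound p := by
    obtain ⟨C, hC⟩ := h.bound p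
    refine ⟨C, fun m x => ?_⟩
    rw [inner_neg_left, abs_neg]
    exact hC m x

/-- Writing $|(v,x)|^m|p|w$ as the square root of $|(v,x)|^{2m}w$ times $|p|^2w$ separates the
polynomial from the moments. Hence the sequence of square roots of even moments, which is still
quasi-analytic. -/
theorem exists_isQASeq {n : ℕ} {w : Weight n} {v : Rn n} (hr : w.RapidDecay)
    (h : ∑' m : ℕ, w.M v (m + 1) ^ (-(1 / ((m : ℝ) + 1))) = ⊤) : ∃ N, IsQASeq w v N := by
  have hfin := w.M_ne_top v h
  have hpos := w.mom_pos v
  have hlc := Weight.mom_logConvex hfin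
  refine ⟨fun m => √(w.mom v (2 * m)), ?_, ?_, ?_, ?_⟩
  · intro m
    rw [Real.one_le_sqrt]
    exact w.one_le_mom v _
  · intro m
    rw [Real.sq_sqrt (hpos _).le, ← Real.sqrt_mul (hpos _).le]
    refine Real.le_sqrt_of_sq_le ?_
    have r1 := ratio_le_of_logConvex hpos hlc (show 2 * m ≤ 2 * m + 2 by omega)
    have r2 := ratio_le_of_logConvex hpos hlc (show 2 * m + 1 ≤ 2 * m + 3 by omega)
    have r3 := mul_le_mul r1 r2 (div_pos (hpos _) (hpos _)).le (div_pos (hpos _) (hpos _)).le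
    rw [div_mul_div_cancel₀ (hpos _).ne', div_mul_div_cancel₀ (hpos _).ne',
      div_le_div_iff₀ (hpos _) (hpos _), ← sq] at r3
    exact r3
  · exact not_summable_ratio_sqrt hpos hlc
      (not_summable_ratio (w.one_le_mom v) (Weight.mom_not_summable h))
  · intro p
    obtain ⟨C, hC⟩ := hr (p * p)
    refine ⟨√C, fun m x => ?_⟩
    have hw := w.nonneg' x
    have h1 : ‖(polyMap n p).1 x‖ ^ 2 * w x ≤ C := by
      refine le_trans (le_of_eq ?_) (hC x)
      rw [polyMap_apply, polyMap_apply, map_mul, norm_mul, sq]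
    have hC0 : 0 ≤ C := le_trans (by positivity) h1
    rw [← Real.sqrt_mul hC0]
    refine Real.le_sqrt_of_sq_le ?_
    calc _ = (‖(polyMap n p).1 x‖ ^ 2 * w x) * (|inner ℝ v x| ^ (2 * m) * w x) := by ring
      _ ≤ C * w.mom v (2 * m) :=
        mul_le_mul h1 (Weight.le_mom hfin _ x) (by positivity) hC0


/-! ### Polynomials times exponentials in `C_w` -/

theorem Weight.RapidDecay.tendsto_zero {n : ℕ} {w : Weight n} (hw : w.RapidDecay)
    {F : Rn n → ℂ} (p : MvPolynomial (Fin n) ℂ)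
    (hF : ∀ x, ‖F x‖ ≤ ‖(polyMap n p).1 x‖ * w x) :
    Filter.Tendsto F (Filter.cocompact (Rn n)) (𝓝 0) := by
  -- This polynomial is $\|x\|^2$; boundedness of `p * q` against the weight gives decay of order
  -- $\|x\|^{-2}$.
  set q : MvPolynomial (Fin n) ℂ := ∑ j, MvPolynomial.X j * MvPolynomial.X j with hq
  obtain ⟨C, hC⟩ := hw (p * q)
  have hqx : ∀ x, ‖(polyMap n q).1 x‖ = ‖x‖ ^ 2 := by
    intro x
    have : (polyMap n q).1 x = ((‖x‖ ^ 2 : ℝ) : ℂ) := by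
      rw [polyMap_apply, EuclideanSpace.real_norm_sq_eq]
      simp [hq, sq]
    rw [this, Complex.norm_real, norm_pow, norm_norm]
  rw [tendsto_cocompact_zero_iff]
  intro ε hε
  have hC0 : 0 ≤ C := (mul_nonneg (norm_nonneg _) (w.nonneg' 0)).trans (hC 0)
  refine ⟨C / ε + 1, fun x hx => (hF x).trans ?_⟩
  have h1 := hC x
  have h2 : ‖(polyMap n (p * q)).1 x‖ = ‖(polyMap n p).1 x‖ * ‖x‖ ^ 2 := by
    rw [← hqx, ← norm_mul, polyMap_apply, map_mul]; rfl
  have hx0 : 0 ≤ C / ε := by positivity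
  have hx1 : C / ε ≤ ‖x‖ ^ 2 := by nlinarith
  have hx2 : 0 < ‖x‖ ^ 2 := by nlinarith
  rw [h2, mul_right_comm, ← le_div_iff₀ hx2] at h1
  refine h1.trans ?_
  rw [div_le_iff₀ hε] at hx1
  rw [div_le_iff₀ hx2]
  linarith

theorem Weight.RapidDecay.vanishesAtInfinity {n : ℕ} {w : Weight n} (hw : w.RapidDecay) :
    w.VanishesAtInfinity := by
  have h := hw.tendsto_zero (F := fun x => (w x : ℂ)) 1 fun x => by
    simp [polyMap_apply, abs_of_nonneg (w.nonneg' x)]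
  have h2 := h.norm
  rw [norm_zero] at h2
  refine h2.congr fun x => ?_
  rw [Complex.norm_real, Real.norm_of_nonneg (w.nonneg' x)]

theorem norm_polyExp_apply {n : ℕ} (p : MvPolynomial (Fin n) ℂ) (t x : Rn n) :
    ‖(polyExp p (ofRn t)).1 x‖ = ‖(polyMap n p).1 x‖ := by
  change ‖(polyMap n p).1 x * (expFun (ofRn t)).1 x‖ = _
  rw [norm_mul, norm_expFun_ofRn, mul_one]

theorem polyExp_mem_cwSub {n : ℕ} {w : Weight n} (hw : w.RapidDecay) (p : MvPolynomial (Fin n) ℂ)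
    (t : Rn n) : polyExp p (ofRn t) ∈ cwSub w := by
  rw [mem_cwSub_iff]
  intro l
  obtain ⟨q, hq⟩ := iterD_polyExp l p (ofRn t)
  rw [hq]
  refine hw.tendsto_zero q fun x => ?_
  rw [norm_mul, norm_polyExp_apply, Complex.norm_real, Real.norm_of_nonneg (w.nonneg' x)]

theorem norm_smooth_add_mul_le {n : ℕ} (w : Weight n) (f g : smooth n) (x : Rn n) {a b : ℝ}
    (hf : ‖f.1 x‖ * w x ≤ a) (hg : ‖g.1 x‖ * w x ≤ b) : ‖(f + g).1 x‖ * w x ≤ a + b := by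
  refine le_trans ?_ (add_le_add hf hg)
  rw [← add_mul]
  exact mul_le_mul_of_nonneg_right (norm_add_le _ _) (w.nonneg' x)

theorem norm_smooth_smul_mul_le {n : ℕ} (w : Weight n) (c : ℂ) (f : smooth n) (x : Rn n) {a C : ℝ}
    (hc : ‖c‖ ≤ C) (hf : ‖f.1 x‖ * w x ≤ a) : ‖(c • f).1 x‖ * w x ≤ C * a := by
  change ‖c * f.1 x‖ * w x ≤ _
  rw [norm_mul, mul_assoc]
  exact mul_le_mul hc hf (mul_nonneg (norm_nonneg _) (w.nonneg' x)) ((norm_nonneg _).trans hc)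

theorem norm_I_mul_ofRn_le {n : ℕ} {t : Rn n} {R : ℝ} (ht : ‖t‖ ≤ R) (j : Fin n) :
    ‖Complex.I * ofRn t j‖ ≤ R := by
  rw [norm_mul, Complex.norm_I, one_mul]
  change ‖((t j : ℝ) : ℂ)‖ ≤ R
  rw [Complex.norm_real]
  exact (PiLp.norm_apply_le t j).trans ht

theorem exists_norm_iterD_polyExp_le {n : ℕ} {w : Weight n} (hw : w.RapidDecay) (R : ℝ)
    (l : List (Fin n)) (p : MvPolynomial (Fin n) ℂ) :
    ∃ C : ℝ, ∀ t : Rn n, ‖t‖ ≤ R → ∀ x, ‖(iterD l (polyExp p (ofRn t))).1 x‖ * w x ≤ C := by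
  induction l using List.reverseRecOn generalizing p with
  | nil =>
    obtain ⟨C, hC⟩ := hw p
    refine ⟨C, fun t _ x => ?_⟩
    rw [iterD_nil, norm_polyExp_apply]
    exact hC x
  | append_singleton l j ih =>
    obtain ⟨C, hC⟩ := ih (MvPolynomial.pderiv j p)
    obtain ⟨D, hD⟩ := ih p
    refine ⟨C + R * D, fun t ht x => ?_⟩
    rw [iterD_concat, partialD_polyExp, map_add, map_smul]
    exact norm_smooth_add_mul_le w _ _ x (hC t ht x)
      (norm_smooth_smul_mul_le w _ _ x (norm_I_mul_ofRn_le ht j) (hD t ht x))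

/-- The polynomial `i (v, x)`. -/
def iLin {n : ℕ} (v : Rn n) : MvPolynomial (Fin n) ℂ :=
  ∑ j, MvPolynomial.C (Complex.I * (v j : ℂ)) * MvPolynomial.X j

theorem eval_iLin {n : ℕ} (v x : Rn n) : MvPolynomial.eval (fun j => (x j : ℂ)) (iLin v) =
    Complex.I * ((inner ℝ v x : ℝ) : ℂ) := by
  simp [iLin, PiLp.inner_apply, Finset.mul_sum, mul_assoc, mul_comm]

theorem pderiv_iLin {n : ℕ} (v : Rn n) (j : Fin n) :
    MvPolynomial.pderiv j (iLin v) = MvPolynomial.C (Complex.I * (v j : ℂ)) := by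
  classical
  simp [iLin, MvPolynomial.pderiv_X, Pi.single_apply]

theorem iLin_single {n : ℕ} (j : Fin n) :
    iLin (EuclideanSpace.single j (1 : ℝ)) = MvPolynomial.C Complex.I * MvPolynomial.X j := by
  classical
  rw [iLin, Finset.sum_eq_single j]
  · simp
  · intro k _ hk
    simp [hk]
  · simp

/-- Derivatives in `x` of $(i(v,x))^m p\,e_{it}$ cost factors `m` and lower the power by one. Both
costs fit into a geometric factor `B ^ m`, which does not affect quasi-analyticity; `B` may depend
on `l` and `p` but not on `m`. -/
theorem IsQASeq.norm_iterD_le {n : ℕ} {w : Weight n} {v : Rn n} {N : ℕ → ℝ} (h : IsQASeq w v N)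
    (R : ℝ) (l : List (Fin n)) (p : MvPolynomial (Fin n) ℂ) :
    ∃ A B : ℝ, 0 ≤ A ∧ 1 ≤ B ∧ ∀ (m : ℕ) (t : Rn n), ‖t‖ ≤ R → ∀ x,
      ‖(iterD l (polyExp (iLin v ^ m * p) (ofRn t))).1 x‖ * w x ≤ A * (B ^ m * N m) := by
  have hN : ∀ m, 0 < N m := fun m => one_pos.trans_le (h.one_le m)
  induction l using List.reverseRecOn generalizing p with
  | nil =>
    obtain ⟨C, hC⟩ := h.bound p
    refine ⟨max C 0, 1, le_max_right _ _, le_rfl, fun m t _ x => ?_⟩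
    rw [iterD_nil, norm_polyExp_apply, polyMap_apply, map_mul, map_pow, eval_iLin, norm_mul,
      norm_pow, norm_mul, Complex.norm_I, one_mul, Complex.norm_real, Real.norm_eq_abs, mul_assoc,
      one_pow, one_mul]
    exact (hC m x).trans (mul_le_mul_of_nonneg_right (le_max_left _ _) (hN m).le)
  | append_singleton l j ih =>
    obtain ⟨A₁, B₁, hA₁, hB₁, h₁⟩ := ih (MvPolynomial.pderiv j p)
    obtain ⟨A₂, B₂, hA₂, hB₂, h₂⟩ := ih p
    set B := max B₁ B₂ with hB
    have hB1 : 1 ≤ B := hB₁.trans (le_max_left _ _)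
    have hR0 : 0 ≤ max R 0 := le_max_right _ _
    refine ⟨A₁ + |v j| * A₂ * N 0 + max R 0 * A₂, 2 * B, ?_, by linarith, fun m t ht x => ?_⟩
    · have := (hN 0).le
      positivity
    have hpow : ∀ b : ℝ, 1 ≤ b → b ≤ B → b ^ m ≤ (2 * B) ^ m := fun b hb hbB =>
      pow_le_pow_left₀ (by linarith) (by linarith) m
    -- For `m = 0` the truncated exponent `m - 1` does no harm, as its coefficient is zero.
    have hd : MvPolynomial.pderiv j (iLin v ^ m * p) = iLin v ^ m * MvPolynomial.pderiv j p +
        MvPolynomial.C (m * (Complex.I * (v j : ℂ))) * (iLin v ^ (m - 1) * p) := by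
      rw [MvPolynomial.pderiv_mul, MvPolynomial.pderiv_pow, pderiv_iLin]
      simp only [map_mul, map_natCast]
      ring
    rw [iterD_concat, partialD_polyExp, hd, polyExp_add, polyExp_C_mul, map_add, map_add, map_smul,
      map_smul]
    have e1 : ‖(iterD l (polyExp (iLin v ^ m * MvPolynomial.pderiv j p) (ofRn t))).1 x‖ * w x ≤
        A₁ * ((2 * B) ^ m * N m) := by
      refine (h₁ m t ht x).trans ?_
      have := hpow B₁ hB₁ (le_max_left _ _)
      have := (hN m).le
      gcongr
    have e2 : ‖((m * (Complex.I * (v j : ℂ))) •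
        iterD l (polyExp (iLin v ^ (m - 1) * p) (ofRn t))).1 x‖ * w x ≤
        |v j| * A₂ * N 0 * ((2 * B) ^ m * N m) := by
      have hc : ‖(m * (Complex.I * (v j : ℂ)) : ℂ)‖ ≤ m * |v j| := by
        simp
      refine (norm_smooth_smul_mul_le w _ _ x hc (h₂ (m - 1) t ht x)).trans ?_
      rcases m with _ | m
      · have h1 := (hN 0).le
        simp only [Nat.cast_zero, zero_mul]
        positivity
      · have h1 : N m ≤ N 0 * N (m + 1) := by
          have h2 := ratio_le_of_logConvex hN h.logConvex (Nat.zero_le m)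
          have h3 : N 0 / N (0 + 1) ≤ N 0 := div_le_self (hN 0).le (h.one_le _)
          exact (div_le_iff₀ (hN _)).1 (h2.trans h3)
        have h4 : ((m + 1 : ℕ) : ℝ) ≤ 2 ^ (m + 1) := by
          exact_mod_cast (Nat.lt_two_pow_self (n := m + 1)).le
        have h5 : B₂ ^ m ≤ B ^ (m + 1) :=
          (pow_le_pow_left₀ (by linarith) (le_max_right _ _) m).trans
            (pow_le_pow_right₀ hB1 (Nat.le_succ m))
        have h6 := (hN m).le
        have h7 := (hN 0).le
        have h8 := (hN (m + 1)).le
        rw [Nat.add_sub_cancel]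
        calc ((m + 1 : ℕ) : ℝ) * |v j| * (A₂ * (B₂ ^ m * N m))
            ≤ 2 ^ (m + 1) * |v j| * (A₂ * (B ^ (m + 1) * (N 0 * N (m + 1)))) := by gcongr
          _ = _ := by rw [mul_pow]; ring
    have e3 : ‖((Complex.I * ofRn t j) • iterD l (polyExp (iLin v ^ m * p) (ofRn t))).1 x‖ * w x ≤
        max R 0 * A₂ * ((2 * B) ^ m * N m) := by
      refine (norm_smooth_smul_mul_le w _ _ x (norm_I_mul_ofRn_le (ht.trans (le_max_left R 0)) j)
        (h₂ m t ht x)).trans ?_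
      rw [mul_assoc]
      have := hpow B₂ hB₂ (le_max_right _ _)
      have := (hN m).le
      gcongr
    refine (norm_smooth_add_mul_le w _ _ x (norm_smooth_add_mul_le w _ _ x e1 e2) e3).trans
      (le_of_eq (by ring))

/-! ### Differentiation in the frequency -/

/-- Differentiating the frequency along `v` multiplies by $i(v,x)$, and this commutes with the
derivatives in `x`: the derivative of the factor $i(t_0+rv)_j$ is exactly the term produced by
$\partial_j$ of $i(v,x)$. -/
theorem hasDerivAt_iterD_polyExp {n : ℕ} (v t₀ x : Rn n) (l : List (Fin n))
    (p : MvPolynomial (Fin n) ℂ) (r : ℝ) :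
    HasDerivAt (fun r : ℝ => (iterD l (polyExp p (ofRn (t₀ + r • v)))).1 x)
      ((iterD l (polyExp (iLin v * p) (ofRn (t₀ + r • v)))).1 x) r := by
  induction l using List.reverseRecOn generalizing p with
  | nil =>
    have e : ∀ (q : MvPolynomial (Fin n) ℂ) (r : ℝ), (polyExp q (ofRn (t₀ + r • v))).1 x =
        MvPolynomial.eval (fun j => (x j : ℂ)) q *
          Complex.exp (Complex.I * (((inner ℝ t₀ x + r * inner ℝ v x : ℝ)) : ℂ)) := by
      intro q r
      rw [polyExp_apply, sum_ofRn_mul, inner_add_left, real_inner_smul_left]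
    simp only [iterD_nil, e, map_mul, eval_iLin]
    have h1 : HasDerivAt (fun r : ℝ => inner ℝ t₀ x + r * inner ℝ v x) (inner ℝ v x) r := by
      simpa using ((hasDerivAt_id r).mul_const (inner ℝ v x)).const_add (inner ℝ t₀ x)
    have h2 := ((h1.ofReal_comp.const_mul Complex.I).cexp).const_mul
      (MvPolynomial.eval (fun j => (x j : ℂ)) p)
    refine h2.congr_deriv ?_
    ring
  | append_singleton l j ih =>
    have h1 := ih (MvPolynomial.pderiv j p)
    have h2 := ih p
    have h3 : HasDerivAt (fun r : ℝ => Complex.I * ofRn (t₀ + r • v) j)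
        (Complex.I * (v j : ℂ)) r := by
      have h4 : HasDerivAt (fun r : ℝ => t₀ j + r * v j) (v j) r := by
        simpa using ((hasDerivAt_id r).mul_const (v j)).const_add (t₀ j)
      exact h4.ofReal_comp.const_mul Complex.I
    have h5 := h1.add (h3.mul h2)
    have e : ∀ (q : MvPolynomial (Fin n) ℂ) (r : ℝ),
        (iterD (l ++ [j]) (polyExp q (ofRn (t₀ + r • v)))).1 x =
          (iterD l (polyExp (MvPolynomial.pderiv j q) (ofRn (t₀ + r • v)))).1 x +
            Complex.I * ofRn (t₀ + r • v) j * (iterD l (polyExp q (ofRn (t₀ + r • v)))).1 x := by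
      intro q r
      rw [iterD_concat, partialD_polyExp, map_add, map_smul]
      rfl
    have hd : MvPolynomial.pderiv j (iLin v * p) = iLin v * MvPolynomial.pderiv j p +
        MvPolynomial.C (Complex.I * (v j : ℂ)) * p := by
      rw [MvPolynomial.pderiv_mul, pderiv_iLin]; ring
    simp only [e]
    refine h5.congr_deriv ?_
    rw [hd, polyExp_add, polyExp_C_mul, map_add, map_smul]
    change _ = ((iterD l (polyExp (iLin v * MvPolynomial.pderiv j p) (ofRn (t₀ + r • v)))).1 x +
      Complex.I * (v j : ℂ) * (iterD l (polyExp p (ofRn (t₀ + r • v)))).1 x) + _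
    ring

/-- Coordinatewise differentiability and a bound on the second derivative give differentiability
in the supremum norm. -/
theorem hasDerivAt_bddFun {n : ℕ} {u u₁ u₂ : ℝ → BddFun n}
    (h₁ : ∀ x t, HasDerivAt (fun t => u t x) (u₁ t x) t)
    (h₂ : ∀ x t, HasDerivAt (fun t => u₁ t x) (u₂ t x) t) {a C : ℝ}
    (hC : ∀ t, |t - a| ≤ 1 → ‖u₂ t‖ ≤ C) : HasDerivAt u (u₁ a) a := by
  have hC0 : 0 ≤ C := (norm_nonneg _).trans (hC a (by simp))
  rw [hasDerivAt_iff_isLittleO_nhds_zero, Asymptotics.isLittleO_iff]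
  intro c hc
  have hev : ∀ᶠ h : ℝ in 𝓝 0, ‖h‖ < min 1 (c / (C + 1)) := by
    have : Filter.Tendsto (fun h : ℝ => ‖h‖) (𝓝 0) (𝓝 0) := tendsto_norm_zero
    exact this.eventually (gt_mem_nhds (by positivity))
  filter_upwards [hev] with h hh
  have hh1 : |h| ≤ 1 := (hh.trans_le (min_le_left _ _)).le
  have hh2 : ‖h‖ ≤ c / (C + 1) := (hh.trans_le (min_le_right _ _)).le
  have hcv : Convex ℝ (Metric.closedBall a |h|) := convex_closedBall _ _
  have ha : a ∈ Metric.closedBall a |h| := Metric.mem_closedBall_self (abs_nonneg _)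
  have hah : a + h ∈ Metric.closedBall a |h| := by simp
  -- The mean value inequality is used twice, for `u₁` and then for `u - t • u₁ a`; the resulting
  -- quadratic bound is uniform in `x`.
  have hmain : ‖u (a + h) - u a - h • u₁ a‖ ≤ C * ‖h‖ * ‖h‖ := by
    refine BddFun.norm_le fun x => ?_
    change ‖u (a + h) x - u a x - h • u₁ a x‖ ≤ _
    have b1 : ∀ t ∈ Metric.closedBall a |h|, ‖u₁ t x - u₁ a x‖ ≤ C * ‖h‖ := by
      intro t ht
      have := hcv.norm_image_sub_le_of_norm_hasDerivWithin_le (f := fun t => u₁ t x)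
        (f' := fun t => u₂ t x) (C := C) (fun y _ => (h₂ x y).hasDerivWithinAt)
        (fun y hy => (lp.norm_apply_le_norm ENNReal.top_ne_zero (u₂ y) x).trans
          (hC y ((Metric.mem_closedBall.1 hy).trans hh1))) ha ht
      refine this.trans (mul_le_mul_of_nonneg_left ?_ hC0)
      exact Metric.mem_closedBall.1 ht
    have b2 := hcv.norm_image_sub_le_of_norm_hasDerivWithin_le
      (f := fun t => u t x - t • u₁ a x) (f' := fun t => u₁ t x - u₁ a x) (C := C * ‖h‖)
      (fun y _ => by
        have := (h₁ x y).sub ((hasDerivAt_id y).smul_const (u₁ a x))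
        rw [one_smul] at this
        exact this.hasDerivWithinAt) b1 ha hah
    have e : u (a + h) x - (a + h) • u₁ a x - (u a x - a • u₁ a x) =
        u (a + h) x - u a x - h • u₁ a x := by
      rw [add_smul]; abel
    rw [e, add_sub_cancel_left] at b2
    exact b2
  refine hmain.trans (mul_le_mul_of_nonneg_right ?_ (norm_nonneg _))
  calc C * ‖h‖ ≤ C * (c / (C + 1)) := by gcongr
    _ ≤ c := by
      rw [mul_div_assoc', div_le_iff₀ (by positivity)]
      nlinarith

theorem hasDerivAt_embedFun_polyExp {n : ℕ} {w : Weight n} (hw : w.RapidDecay)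
    (s : Finset (Fin n → ℕ)) (v t₀ : Rn n) (p : MvPolynomial (Fin n) ℂ) (r : ℝ) :
    HasDerivAt (fun r : ℝ => embedFun w s (polyExp p (ofRn (t₀ + r • v))))
      (embedFun w s (polyExp (iLin v * p) (ofRn (t₀ + r • v)))) r := by
  rw [hasDerivAt_pi]
  intro α
  have hx : ∀ (q : MvPolynomial (Fin n) ℂ) (r : ℝ) (x : Rn n),
      embedFun w s (polyExp q (ofRn (t₀ + r • v))) α x =
        (iterD (multiList α.1) (polyExp q (ofRn (t₀ + r • v)))).1 x * (w x : ℂ) := by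
    intro q r x
    rw [embedFun_apply s (polyExp_mem_cwSub hw _ _), multiD_eq_iterD]
  have hder : ∀ (q : MvPolynomial (Fin n) ℂ) (x : Rn n) (r : ℝ), HasDerivAt
      (fun r : ℝ => embedFun w s (polyExp q (ofRn (t₀ + r • v))) α x)
      (embedFun w s (polyExp (iLin v * q) (ofRn (t₀ + r • v))) α x) r := by
    intro q x r
    simp only [hx]
    exact (hasDerivAt_iterD_polyExp v t₀ x _ q r).mul_const _
  obtain ⟨C, hC⟩ := exists_norm_iterD_polyExp_le hw (‖t₀‖ + (|r| + 1) * ‖v‖) (multiList α.1)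
    (iLin v * (iLin v * p))
  refine hasDerivAt_bddFun (u := fun r => embedFun w s (polyExp p (ofRn (t₀ + r • v))) α)
    (u₁ := fun r => embedFun w s (polyExp (iLin v * p) (ofRn (t₀ + r • v))) α)
    (u₂ := fun r => embedFun w s (polyExp (iLin v * (iLin v * p)) (ofRn (t₀ + r • v))) α) (C := C)
    (hder p) (hder _) fun y hy => BddFun.norm_le fun x => ?_
  rw [hx, norm_mul, Complex.norm_real, Real.norm_of_nonneg (w.nonneg' x)]
  refine hC _ ?_ x
  refine (norm_add_le _ _).trans (add_le_add le_rfl ?_)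
  rw [norm_smul, Real.norm_eq_abs]
  refine mul_le_mul_of_nonneg_right ?_ (norm_nonneg _)
  have := abs_sub_abs_le_abs_sub y r
  linarith

/-! ### Functionals and quasi-analyticity -/

/-- Along the segment, $y\mapsto T(p\,e_{i(t_0+yv)})$ has `m`-th derivative $T((i(v,x))^m
p\,e_{i(t_0+yv)})$. All of these vanish at `y = 0` because `hT` covers every polynomial, so
Denjoy–Carleman applies. -/
theorem IsQASeq.functional_eq_zero_of_nonneg {n : ℕ} {w : Weight n} (hw : w.RapidDecay) {v : Rn n}
    {N : ℕ → ℝ} (h : IsQASeq w v N) (s : Finset (Fin n → ℕ)) (T : (s → BddFun n) →L[ℂ] ℂ)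
    (t₀ : Rn n) (hT : ∀ p, T (embedFun w s (polyExp p (ofRn t₀))) = 0) (p : MvPolynomial (Fin n) ℂ)
    {r : ℝ} (hr : 0 ≤ r) : T (embedFun w s (polyExp p (ofRn (t₀ + r • v)))) = 0 := by
  have hN : ∀ m, 0 < N m := fun m => one_pos.trans_le (h.one_le m)
  set R := ‖t₀‖ + r * ‖v‖ with hR
  choose A B hA hB hAB using fun α : s => h.norm_iterD_le R (multiList α.1) p
  set A' := ∑ α, A α with hA'
  set B' := 1 + ∑ α, B α with hB'
  have hB0 : ∀ α, 0 ≤ B α := fun α => zero_le_one.trans (hB α)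
  have hB1 : 1 ≤ B' := by
    have := Finset.sum_nonneg fun α (_ : α ∈ Finset.univ) => hB0 α
    linarith
  have hA0 : 0 ≤ A' := Finset.sum_nonneg fun α _ => hA α
  set D := (‖T‖ + 1) * (A' + 1) with hD
  have hD0 : 0 < D := by positivity
  set M : ℕ → ℝ := fun m => D * (B' ^ m * N m) with hM
  have hM0 : ∀ m, 0 < M m := fun m => by
    have := hN m
    positivity
  have hlc : ∀ m, M (m + 1) ^ 2 ≤ M m * M (m + 2) := by
    intro m
    calc M (m + 1) ^ 2 = (D ^ 2 * B' ^ (2 * m + 2)) * N (m + 1) ^ 2 := by simp only [hM]; ring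
      _ ≤ (D ^ 2 * B' ^ (2 * m + 2)) * (N m * N (m + 2)) := by
        have := h.logConvex m
        gcongr
      _ = M m * M (m + 2) := by simp only [hM]; ring
  have hns : ¬ Summable fun m => M m / M (m + 1) := by
    intro hs
    refine h.not_summable ((hs.mul_left B').congr fun m => ?_)
    have h1 := (hN m).ne'
    have h2 := (hN (m + 1)).ne'
    have h3 : B' ≠ 0 := by positivity
    simp only [hM]
    field_simp
    ring
  have hflat := eq_zero_of_flat hM0 hlc hns (R := r)
    (f := fun m y => T (embedFun w s (polyExp (iLin v ^ m * p) (ofRn (t₀ + y • v))))) ?_ ?_ ?_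
    r ⟨hr, le_rfl⟩
  · simpa using hflat
  · intro m y
    have := (hasDerivAt_embedFun_polyExp hw s v t₀ (iLin v ^ m * p) y)
    have h2 := (T.hasFDerivAt.restrictScalars ℝ).comp_hasDerivAt y this
    rw [← mul_assoc, ← pow_succ'] at h2
    exact h2
  · intro m y hy
    have hy' : ‖t₀ + y • v‖ ≤ R := by
      refine (norm_add_le _ _).trans (add_le_add le_rfl ?_)
      rw [norm_smul, Real.norm_of_nonneg hy.1]
      exact mul_le_mul_of_nonneg_right hy.2 (norm_nonneg _)
    have h1 : ‖embedFun w s (polyExp (iLin v ^ m * p) (ofRn (t₀ + y • v)))‖ ≤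
        A' * (B' ^ m * N m) := by
      have hNm := (hN m).le
      refine (pi_norm_le_iff_of_nonneg (by positivity)).2 fun α => BddFun.norm_le fun x => ?_
      rw [embedFun_apply s (polyExp_mem_cwSub hw _ _), multiD_eq_iterD, norm_mul,
        Complex.norm_real, Real.norm_of_nonneg (w.nonneg' x)]
      refine (hAB α m _ hy' x).trans ?_
      have a1 : A α ≤ A' := Finset.single_le_sum (f := A) (fun α _ => hA α) (Finset.mem_univ α)
      have a2 : B α ≤ B' := by
        have := Finset.single_le_sum (f := B) (fun α _ => hB0 α) (Finset.mem_univ α)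
        linarith
      have a3 := hB0 α
      gcongr
    have hNm := (hN m).le
    calc _ ≤ ‖T‖ * (A' * (B' ^ m * N m)) := T.le_opNorm_of_le h1
      _ ≤ (‖T‖ + 1) * ((A' + 1) * (B' ^ m * N m)) := by gcongr <;> linarith
      _ = M m := by simp only [hM, hD]; ring
  · intro m
    simpa using hT (iLin v ^ m * p)

theorem IsQASeq.functional_eq_zero {n : ℕ} {w : Weight n} (hw : w.RapidDecay) {v : Rn n}
    {N : ℕ → ℝ} (h : IsQASeq w v N) (s : Finset (Fin n → ℕ)) (T : (s → BddFun n) →L[ℂ] ℂ)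
    (t₀ : Rn n) (hT : ∀ p, T (embedFun w s (polyExp p (ofRn t₀))) = 0) (r : ℝ)
    (p : MvPolynomial (Fin n) ℂ) : T (embedFun w s (polyExp p (ofRn (t₀ + r • v)))) = 0 := by
  rcases le_total 0 r with hr | hr
  · exact h.functional_eq_zero_of_nonneg hw s T t₀ hT p hr
  · have := h.neg.functional_eq_zero_of_nonneg hw s T t₀ hT p (neg_nonneg.2 hr)
    rwa [smul_neg, neg_smul, neg_neg] at this

/-- For a quasi-analytic weight, a functional that vanishes on `𝒫 e_{iλ}` for one real `λ`
vanishes on all these spaces. -/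
theorem functional_eq_zero_of_polyExp {n : ℕ} {w : Weight n} (hw : w.IsQuasiAnalytic)
    (s : Finset (Fin n → ℕ)) (T : (s → BddFun n) →L[ℂ] ℂ) (t₀ : Rn n)
    (hT : ∀ p, T (embedFun w s (polyExp p (ofRn t₀))) = 0) (t : Rn n)
    (p : MvPolynomial (Fin n) ℂ) : T (embedFun w s (polyExp p (ofRn t))) = 0 := by
  obtain ⟨v, hv⟩ := hw
  have hr := hv.rapidDecay
  -- The path from `t₀` to `t` follows one basis vector at a time; vanishing for all `p` at each
  -- corner supplies the flatness needed for the next direction.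
  have key : ∀ S : Finset (Fin n), ∀ p,
      T (embedFun w s (polyExp p (ofRn (t₀ + ∑ j ∈ S, v.repr (t - t₀) j • v j)))) = 0 := by
    intro S
    induction S using Finset.induction_on with
    | empty => simpa using hT
    | insert j S hj ih =>
      intro p
      obtain ⟨N, hN⟩ := exists_isQASeq hr (hv j)
      have := hN.functional_eq_zero hr s T _ ih (v.repr (t - t₀) j) p
      rw [Finset.sum_insert hj, add_comm (v.repr (t - t₀) j • v j), ← add_assoc]
      exact this
  have h1 := key Finset.univ p
  rwa [v.sum_repr, add_sub_cancel] at h1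

theorem embedFun_add {n : ℕ} {w : Weight n} (s : Finset (Fin n → ℕ)) {f g : smooth n}
    (hf : f ∈ cwSub w) (hg : g ∈ cwSub w) :
    embedFun w s (f + g) = embedFun w s f + embedFun w s g :=
  (embed w s).map_add (Cw.of hf) (Cw.of hg)

theorem embedFun_smul {n : ℕ} {w : Weight n} (s : Finset (Fin n → ℕ)) (c : ℂ) {f : smooth n}
    (hf : f ∈ cwSub w) : embedFun w s (c • f) = c • embedFun w s f :=
  (embed w s).map_smul c (Cw.of hf)

/-- A functional that vanishes on `e_{iλ}` for `λ` in an open set vanishes on `𝒫 e_{iλ}` for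
these `λ`. -/
theorem functional_polyExp_eq_zero_of_isOpen {n : ℕ} {w : Weight n} (hw : w.RapidDecay)
    (s : Finset (Fin n → ℕ)) (T : (s → BddFun n) →L[ℂ] ℂ) {U : Set (Rn n)} (hU : IsOpen U)
    (hT : ∀ t ∈ U, T (embedFun w s (expFun (ofRn t))) = 0) (p : MvPolynomial (Fin n) ℂ) :
    ∀ t ∈ U, T (embedFun w s (polyExp p (ofRn t))) = 0 := by
  induction p using MvPolynomial.induction_on with
  | C a =>
    intro t ht
    rw [← mul_one (MvPolynomial.C a), polyExp_C_mul, embedFun_smul s a (polyExp_mem_cwSub hw _ _),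
      map_smul, polyExp_one, hT t ht, smul_zero]
  | add p q hp hq =>
    intro t ht
    rw [polyExp_add, embedFun_add s (polyExp_mem_cwSub hw _ _) (polyExp_mem_cwSub hw _ _), map_add,
      hp t ht, hq t ht, add_zero]
  | mul_X p j hp =>
    intro t ht
    set v : Rn n := EuclideanSpace.single j 1 with hv
    -- Since `T` of $p\,e_{i(t+re_j)}$ vanishes for small `r`, so does its derivative at 0, which is
    -- $i\,T(x_jp\,e_{it})$.
    have hd := (T.hasFDerivAt.restrictScalars ℝ).comp_hasDerivAt (0 : ℝ)
      (hasDerivAt_embedFun_polyExp hw s v t p 0)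
    have hz : (T ∘ fun r : ℝ => embedFun w s (polyExp p (ofRn (t + r • v)))) =ᶠ[𝓝 0]
        fun _ => (0 : ℂ) := by
      have hc : Continuous fun r : ℝ => t + r • v := by fun_prop
      have : ∀ᶠ r : ℝ in 𝓝 0, t + r • v ∈ U :=
        hc.continuousAt.eventually_mem (hU.mem_nhds (by simpa using ht))
      filter_upwards [this] with r hr
      exact hp _ hr
    have h0 := hd.unique ((hasDerivAt_const (0 : ℝ) (0 : ℂ)).congr_of_eventuallyEq hz)
    rw [zero_smul, add_zero] at h0
    change T (embedFun w s (polyExp (iLin v * p) (ofRn t))) = 0 at h0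
    rw [hv, iLin_single, mul_assoc, polyExp_C_mul, embedFun_smul s _ (polyExp_mem_cwSub hw _ _),
      map_smul, smul_eq_mul] at h0
    rw [mul_comm p]
    exact (mul_eq_zero.1 h0).resolve_left Complex.I_ne_zero


/-! ### Density of the admissible spaces -/

theorem expSpan_le_cwSub {n : ℕ} {w : Weight n} {E : Set (Cn n)}
    (hE : ∀ z ∈ E, expFun z ∈ cwSub w) : expSpan E ≤ cwSub w := by
  refine Submodule.span_le.2 ?_
  rintro _ ⟨z, hz, rfl⟩
  exact hE z hz

theorem expSpan_image_ofRn_le {n : ℕ} {w : Weight n} (hw : w.VanishesAtInfinity)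
    (E : Set (Rn n)) : expSpan (ofRn '' E) ≤ cwSub w := by
  refine expSpan_le_cwSub ?_
  rintro _ ⟨t, -, rfl⟩
  exact expFun_ofRn_mem_cwSub hw t

theorem expFun_mem_expSpan {n : ℕ} {E : Set (Cn n)} {z : Cn n} (hz : z ∈ E) :
    expFun z ∈ expSpan E :=
  Submodule.subset_span ⟨z, hz, rfl⟩

theorem polySub_le_cwSub {n : ℕ} {w : Weight n} (hw : w.RapidDecay) : polySub n ≤ cwSub w := by
  rintro _ ⟨p, rfl⟩
  have h := polyExp_mem_cwSub hw p 0
  rwa [show ofRn (0 : Rn n) = 0 by ext; simp [ofRn], polyExp_zero] at h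

theorem dense_expSpan_of_dense {n : ℕ} {w : Weight n} (hw : w.VanishesAtInfinity)
    {E : Set (Rn n)} (hE : Dense E) :
    Dense (Cw.restrict w (expSpan (ofRn '' E)) : Set (Cw w)) :=
  dense_of_functional (expSpan_image_ofRn_le hw E) fun s T hT =>
    functional_schwartz_eq_zero hw s T fun t => functional_eq_zero_of_dense hw s T
      (fun _ hu => hT _ (expFun_mem_expSpan (Set.mem_image_of_mem _ hu))) t (hE t)

theorem Weight.IsQuasiAnalytic.rapidDecay {n : ℕ} {w : Weight n} (hw : w.IsQuasiAnalytic) :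
    w.RapidDecay :=
  let ⟨_, hv⟩ := hw
  hv.rapidDecay

theorem functional_schwartz_eq_zero_of_polyExp {n : ℕ} {w : Weight n} (hw : w.IsQuasiAnalytic)
    (s : Finset (Fin n → ℕ)) (T : (s → BddFun n) →L[ℂ] ℂ) (t₀ : Rn n)
    (hT : ∀ p, T (embedFun w s (polyExp p (ofRn t₀))) = 0) (f : 𝓢(Rn n, ℂ)) :
    T (embedFun w s (schwartzIncl n f)) = 0 := by
  refine functional_schwartz_eq_zero hw.rapidDecay.vanishesAtInfinity s T (fun t => ?_) f
  rw [← polyExp_one]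
  exact functional_eq_zero_of_polyExp hw s T t₀ hT t 1

theorem dense_polySub {n : ℕ} {w : Weight n} (hw : w.IsQuasiAnalytic) :
    Dense (Cw.restrict w (polySub n) : Set (Cw w)) := by
  refine dense_of_functional (polySub_le_cwSub hw.rapidDecay) fun s T hT =>
    functional_schwartz_eq_zero_of_polyExp hw s T 0 fun p => ?_
  rw [show ofRn (0 : Rn n) = 0 by ext; simp [ofRn], polyExp_zero]
  exact hT _ ⟨p, rfl⟩

theorem dense_expSpan_of_interior {n : ℕ} {w : Weight n} (hw : w.IsQuasiAnalytic)
    {E : Set (Rn n)} (hE : (interior (closure E)).Nonempty) :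
    Dense (Cw.restrict w (expSpan (ofRn '' E)) : Set (Cw w)) := by
  have hw0 := hw.rapidDecay.vanishesAtInfinity
  obtain ⟨t₀, ht₀⟩ := hE
  refine dense_of_functional (expSpan_image_ofRn_le hw0 E) fun s T hT =>
    functional_schwartz_eq_zero_of_polyExp hw s T t₀ fun p =>
      functional_polyExp_eq_zero_of_isOpen hw.rapidDecay s T isOpen_interior (fun t ht => ?_) p
        t₀ ht₀
  exact functional_eq_zero_of_dense hw0 s T
    (fun _ hu => hT _ (expFun_mem_expSpan (Set.mem_image_of_mem _ hu))) t (interior_subset ht)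

theorem dense_expSpan_of_isUniquenessSet {n : ℕ} {w : Weight n} (hw : w.IsHolomorphic)
    {E : Set (Cn n)} (hE : IsUniquenessSet E w.tube) :
    Dense (Cw.restrict w (expSpan E) : Set (Cw w)) :=
  dense_of_functional (expSpan_le_cwSub fun _ hz => expFun_mem_of_mem_tube (hE.1 hz))
    fun s T hT => functional_schwartz_eq_zero hw.vanishesAtInfinity s T fun t =>
      functional_eq_zero_of_isUniquenessSet s T hE (fun _ hz => hT _ (expFun_mem_expSpan hz)) _
        (ofRn_mem_tube hw t)

theorem IsAdmissible.le_and_dense {n : ℕ} {w : Weight n} {L : Submodule ℂ (smooth n)}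
    (hL : IsAdmissible w L) : L ≤ cwSub w ∧ Dense (Cw.restrict w L : Set (Cw w)) := by
  rcases hL with ⟨-, h⟩ | ⟨hw, -, h | ⟨E, hE, rfl⟩⟩ | ⟨hw, -, h | ⟨E, hE, rfl⟩ | rfl⟩ |
    ⟨hw, h | ⟨E, hE, rfl⟩ | rfl⟩
  · exact ⟨h.le_cwSub, h.dense⟩
  · exact ⟨h.le_cwSub, h.dense⟩
  · exact ⟨expSpan_image_ofRn_le hw E, dense_expSpan_of_dense hw hE⟩
  · exact ⟨h.le_cwSub, h.dense⟩
  · exact ⟨expSpan_image_ofRn_le hw.rapidDecay.vanishesAtInfinity E, dense_expSpan_of_interior hw hE⟩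
  · exact ⟨polySub_le_cwSub hw.rapidDecay, dense_polySub hw⟩
  · exact ⟨h.le_cwSub, h.dense⟩
  · exact ⟨expSpan_le_cwSub fun _ hz => expFun_mem_of_mem_tube (hE.1 hz),
      dense_expSpan_of_isUniquenessSet hw hE⟩
  · exact ⟨polySub_le_cwSub hw.isQuasiAnalytic.rapidDecay, dense_polySub hw.isQuasiAnalytic⟩

end QAWeight

end

theorem theorem4p12 (n : ℕ) (w : QAWeight.Weight n) :
    (∀ L : Submodule ℂ (QAWeight.smooth n), QAWeight.IsAdmissible w L → L ≤ QAWeight.cwSub w) ∧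
    (∀ L L' : Submodule ℂ (QAWeight.smooth n),
      QAWeight.IsAdmissible w L → QAWeight.IsAdmissible w L' →
      closure (QAWeight.Cw.restrict w L : Set (QAWeight.Cw w)) =
        closure (QAWeight.Cw.restrict w L' : Set (QAWeight.Cw w))) ∧
    (∀ L : Submodule ℂ (QAWeight.smooth n), QAWeight.IsAdmissible w L →
      Dense (QAWeight.Cw.restrict w L : Set (QAWeight.Cw w))) :=
  ⟨fun _ hL => hL.le_and_dense.1,
    fun _ _ hL hL' => hL.le_and_dense.2.closure_eq.trans hL'.le_and_dense.2.closure_eq.symm,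
    fun _ hL => hL.le_and_dense.2⟩
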